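/- Fix $\lambda>1$. For $d\ge 1$ let ${\bf M}={\bf G}+\lambda\,{\bf u}_l{\bf u}_r^*$, where ${\bf G}\sim\mathrm{GinOE}(d)$ (a real $d\times d$ matrix with i.i.d. $\mathcal N(0,1/d)$ entries), ${\bf u}_l,{\bf u}_r$ are uniformly distributed on the Euclidean unit sphere $\mathcal S^{d-1}\subset\mathbb R^d$, and ${\bf G},{\bf u}_l,{\bf u}_r$ are independent. A two-side query algorithm making $T$ queries chooses adaptively, for $t=1,\dots,T$, a vector $v^{(t)}\in\mathbb C^d$ as a measurable function of its internal random seed (which is independent of ${\bf G},{\bf u}_l,{\bf u}_r$) and of the previous triples $(v^{(s)},w^{(s)},z^{(s)})_{s<t}$, and receives $w^{(t)}={\bf M}v^{(t)}$ and $z^{(t)}={\bf M}^*v^{(t)}$; at the end it outputs unit vectors $\hat v_l,\hat v_r\in\mathbb R^d$ that are measurable functions of the seed and of all $T$ triples. Then there is a function $\varepsilon:\mathbb N\to\mathbb R$, depending only on $\lambda$, with $\varepsilon(d)\to 0$ as $d\to\infty$, such that for every $d\ge1$, every $T\le \frac{\log d}{5(\lambda-1)}$ and every two-side query algorithm making $T$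 queries, with probability at least $1-\varepsilon(d)$ the algorithm fails to find unit vectors with $|\langle\hat v_l,{\bf u}_l\rangle|^2+|\langle\hat v_r,{\bf u}_r\rangle|^2\ge\frac{\lambda-1}{4}$; that is, $$\mathbb P\Big[\,|\langle\hat v_l,{\bf u}_l\rangle|^2+|\langle\hat v_r,{\bf u}_r\rangle|^2<\tfrac{\lambda-1}{4}\Big]\ \ge\ 1-\varepsilon(d).$$ -/

import Mathlib

open MeasureTheory ProbabilityTheory Filter Topology
open scoped Matrix NNReal ENNReal

noncomputable section

namespace TwoSideQuery

/-- The unit sphere of `ℝ^d` (with the Euclidean norm). -/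
abbrev UnitSphere (d : ℕ) : Type :=
  Metric.sphere (0 : EuclideanSpace ℝ (Fin d)) 1

/-- The uniform distribution on the unit sphere of `ℝ^d`: the surface measure, normalized. -/
def uniformSphere (d : ℕ) : Measure (UnitSphere d) :=
  ((volume : Measure (EuclideanSpace ℝ (Fin d))).toSphere Set.univ)⁻¹ •
    (volume : Measure (EuclideanSpace ℝ (Fin d))).toSphere

/-- The real Ginibre ensemble `GinOE(d)`: the law of a real `d × d` matrix with independent
entries of law `N(0, 1/d)`. The matrix is given by its family of entries. -/
def ginOE (d : ℕ) : Measure (Fin d → Fin d → ℝ) :=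
  Measure.pi fun _ : Fin d => Measure.pi fun _ : Fin d => gaussianReal 0 ((d : ℝ≥0)⁻¹)

/-- The perturbed matrix `M = G + lam • u_l u_r^*`. -/
def perturbed {d : ℕ} (lam : ℝ) (G : Fin d → Fin d → ℝ) (ul ur : UnitSphere d) :
    Matrix (Fin d) (Fin d) ℝ :=
  Matrix.of G + lam • Matrix.vecMulVec ul.1.ofLp ur.1.ofLp

/-- What one iteration adds to the history: a triple `(v, w, z)`, to be filled in with
`w = M v` and `z = M^* v`. The vectors are complex, which contains the case of real queries. -/
abbrev Triple (d : ℕ) : Type := (Fin d → ℂ) × (Fin d → ℂ) × (Fin d → ℂ)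

/-- The answer of the two-side oracle for the real matrix `M` to the query `v`, together with the
query itself. -/
def answer {d : ℕ} (M : Matrix (Fin d) (Fin d) ℝ) (v : Fin d → ℂ) : Triple d :=
  (v, M.map Complex.ofReal *ᵥ v, (M.map Complex.ofReal)ᴴ *ᵥ v)

/-- A randomized adaptive two-side query algorithm in dimension `d` that makes `T` queries and has
its internal randomness (seed) in `R`. The `k`-th query (counted from `0`) is a function of the
seed and the history of the first `k` iterations; only `query k` with `k < T` is ever used.
After `T` iterations two unit vectors of `ℝ^d` are output. -/
structure Algorithm (d T : ℕ) (R : Type*) [MeasurableSpace R] where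
  query : (k : ℕ) → R → (Fin k → Triple d) → (Fin d → ℂ)
  measurable_query : ∀ k, Measurable (fun x : R × (Fin k → Triple d) => query k x.1 x.2)
  outLeft : R → (Fin T → Triple d) → UnitSphere d
  measurable_outLeft : Measurable (fun x : R × (Fin T → Triple d) => outLeft x.1 x.2)
  outRight : R → (Fin T → Triple d) → UnitSphere d
  measurable_outRight : Measurable (fun x : R × (Fin T → Triple d) => outRight x.1 x.2)

namespace Algorithm

variable {d T : ℕ} {R : Type*} [MeasurableSpace R]

/-- The history after `k` iterations on the matrix `M` with seed `r`. -/
def history (A : Algorithm d T R) (M : Matrix (Fin d) (Fin d) ℝ) (r : R) :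
    (k : ℕ) → (Fin k → Triple d)
  | 0 => Fin.elim0
  | k + 1 => Fin.snoc (α := fun _ => Triple d) (A.history M r k)
      (answer M (A.query k r (A.history M r k)))

/-- The output `v̂_l` after `T` iterations. -/
def vLeft (A : Algorithm d T R) (M : Matrix (Fin d) (Fin d) ℝ) (r : R) : UnitSphere d :=
  A.outLeft r (A.history M r T)

/-- The output `v̂_r` after `T` iterations. -/
def vRight (A : Algorithm d T R) (M : Matrix (Fin d) (Fin d) ℝ) (r : R) : UnitSphere d :=
  A.outRight r (A.history M r T)

/-- The total overlap `|⟨v̂_l, u_l⟩|² + |⟨v̂_r, u_r⟩|²` of the outputs on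
`M = G + lam • u_l u_r^*`. -/
def overlap (A : Algorithm d T R) (lam : ℝ) (r : R) (G : Fin d → Fin d → ℝ)
    (ul ur : UnitSphere d) : ℝ :=
  |inner ℝ (A.vLeft (perturbed lam G ul ur) r).1 ul.1| ^ 2 +
    |inner ℝ (A.vRight (perturbed lam G ul ur) r).1 ur.1| ^ 2

end Algorithm

/-- The joint law of the seed `r`, the matrix `G` and the vectors `u_l`, `u_r`: independent, with
`r` of law `ν`, `G` of law `GinOE(d)` and `u_l`, `u_r` uniform on the unit sphere. -/
def jointLaw {R : Type*} [MeasurableSpace R] (d : ℕ) (ν : Measure R) :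
    Measure (R × (Fin d → Fin d → ℝ) × UnitSphere d × UnitSphere d) :=
  ν.prod ((ginOE d).prod ((uniformSphere d).prod (uniformSphere d)))

end TwoSideQuery

end

/-!
Fix the seed, so that the algorithm is deterministic. Let `P k` be the orthogonal projection onto
the span of the real and imaginary parts of the first `k` queries, and let the overlap after `k`
queries be `|P k u_l|² + |P k u_r|²`. The outputs are treated as one more query, so that it suffices
to control the growth of this overlap: except with small probability, one query multiplies it by at
most `lam ^ 4`, once it has the size `(log d)² / d`. After `log d / (5 (lam - 1))` queries it is then
at most of order `d ^ (-1 / 5) (log d)²`, which tends to `0`.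

The growth in one step is bounded by a change of measure.

* Conditionally on the history, the block `(1 - P k) G (1 - P k)` is Gaussian and independent of the
  observed part of `G` (`Algorithm.lintegral_history_resample`). Together with the Cameron–Martin
  formula (`map_add_ginOE`), this gives the likelihood ratio of the history for the matrix
  `G + lam u_l u_r^*` against `G` (`Algorithm.lintegral_history_add`).
* While the overlap is at most `τ`, the `p`-th power of this ratio is at most
  `exp ((p² - p) / 2 * lam² d τ)` times another likelihood ratio, which has mean `1`
  (`exp_mul_log_likelihood_le`).
* For the matrix `G` alone, the history is independent of `u_l` and `u_r`, so that the next query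
  has an overlap of at least `τ'` with probability about `exp (-d τ' / 2)`. This follows from the
  exponential moments of a projection of a uniform unit vector (`lintegral_exp_projSq_le`), which
  are computed from the volume of an ellipsoid in polar coordinates.

Splitting according to whether the likelihood ratio exceeds `exp κ`, these facts combine to
`Algorithm.measure_overlap_increase_le`. Taking an exponent `p` close to `1` rather than `p = 2` is
what allows a growth factor that tends to `1` with `lam`; the choice `p = lam` suffices.
-/

noncomputable section

namespace TwoSideQuery

/-! ### The Gaussian measure on matrices -/

/-- The Frobenius inner product of two real matrices. -/
def frob {d : ℕ} (A B : Matrix (Fin d) (Fin d) ℝ) : ℝ := ∑ i, ∑ j, A i j * B i j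

section Frob

variable {d : ℕ} (A B C R : Matrix (Fin d) (Fin d) ℝ)

lemma frob_eq_trace : frob A B = (Aᵀ * B).trace := by
  simp only [frob, Matrix.trace, Matrix.diag, Matrix.mul_apply, Matrix.transpose_apply]
  exact Finset.sum_comm

lemma frob_comm : frob A B = frob B A := by simp only [frob, mul_comm]

lemma frob_add_left : frob (A + B) C = frob A C + frob B C := by
  simp [frob, add_mul, Finset.sum_add_distrib]

lemma frob_sub_left : frob (A - B) C = frob A C - frob B C := by
  simp [frob, sub_mul, Finset.sum_sub_distrib]

lemma frob_sub_right : frob A (B - C) = frob A B - frob A C := by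
  simp [frob, mul_sub, Finset.sum_sub_distrib]

lemma frob_smul_left (c : ℝ) : frob (c • A) B = c * frob A B := by
  simp [frob, Finset.mul_sum, mul_assoc]

lemma frob_smul_right (c : ℝ) : frob A (c • B) = c * frob A B := by
  rw [frob_comm, frob_smul_left, frob_comm]

variable {R}

/-- Compression by a symmetric matrix is self-adjoint for the Frobenius inner product. -/
lemma frob_compress (hR : Rᵀ = R) : frob (R * A * R) B = frob A (R * B * R) := by
  rw [frob_eq_trace, frob_eq_trace]
  simp only [Matrix.transpose_mul, hR]
  rw [Matrix.mul_assoc, Matrix.trace_mul_comm]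
  simp only [Matrix.mul_assoc]

end Frob

instance (d : ℕ) : IsProbabilityMeasure (ginOE d) := by
  unfold ginOE; infer_instance

/-- The Laplace transform of `ginOE d` at complex arguments. It determines both the rotation
invariance and the behaviour under translations. -/
lemma integral_cexp_ginOE {d : ℕ} (Z : Fin d → Fin d → ℂ) :
    ∫ G, Complex.exp (∑ i, ∑ j, Z i j * G i j) ∂ginOE d
      = Complex.exp ((∑ i, ∑ j, Z i j ^ 2) / (2 * d)) := by
  have h1 : ∀ z : ℂ, ∫ x : ℝ, Complex.exp (z * x) ∂gaussianReal 0 ((d : ℝ≥0)⁻¹)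
      = Complex.exp (z ^ 2 / (2 * d)) := by
    intro z
    have := complexMGF_id_gaussianReal (μ := 0) (v := (d : ℝ≥0)⁻¹) z
    simp only [complexMGF, id] at this
    rw [this]
    congr 1
    push_cast
    ring
  simp_rw [Complex.exp_sum]
  unfold ginOE
  rw [integral_fintype_prod_eq_prod
    (f := fun i (x : Fin d → ℝ) => ∏ j, Complex.exp (Z i j * x j))]
  have h2 : ∀ i, ∫ x : Fin d → ℝ, ∏ j, Complex.exp (Z i j * x j)
      ∂(Measure.pi fun _ => gaussianReal 0 ((d : ℝ≥0)⁻¹))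
      = ∏ j, Complex.exp (Z i j ^ 2 / (2 * d)) := by
    intro i
    rw [integral_fintype_prod_eq_prod (f := fun j (x : ℝ) => Complex.exp (Z i j * x))]
    simp_rw [h1]
  simp_rw [h2]
  simp_rw [← Complex.exp_sum, ← Finset.sum_div]

/-- A continuous functional on matrices is the Frobenius product with a matrix. -/
lemma exists_frob_eq {d : ℕ} (L : StrongDual ℝ (Fin d → Fin d → ℝ)) :
    ∃ C : Matrix (Fin d) (Fin d) ℝ, ∀ G, L G = frob (Matrix.of G) C := by
  refine ⟨fun i j => L (Pi.single i (Pi.single j 1)), fun G => ?_⟩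
  have hG : G = ∑ i, ∑ j, G i j • (Pi.single i (Pi.single j 1) : Fin d → Fin d → ℝ) := by
    ext a b
    simp only [Finset.sum_apply, Pi.smul_apply, smul_eq_mul]
    rw [Finset.sum_eq_single a, Finset.sum_eq_single b]
    · simp
    · intro j _ hj; simp [hj.symm]
    · simp
    · intro i _ hi; simp [hi.symm]
    · simp
  conv_lhs => rw [hG]
  simp [frob, map_sum]

lemma continuous_frob_of {d : ℕ} (C : Matrix (Fin d) (Fin d) ℝ) :
    Continuous fun G : Fin d → Fin d → ℝ => frob (Matrix.of G) C := by
  unfold frob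
  simp only [Matrix.of_apply]
  fun_prop

lemma integral_cexp_frob_ginOE {d : ℕ} (C : Matrix (Fin d) (Fin d) ℝ) :
    ∫ G, Complex.exp (frob (Matrix.of G) C * Complex.I) ∂ginOE d
      = Complex.exp (-(frob C C / (2 * d))) := by
  have := integral_cexp_ginOE (d := d) fun i j => C i j * Complex.I
  convert this using 2
  · ext G
    congr 1
    simp only [frob, Matrix.of_apply]
    push_cast
    simp_rw [Finset.sum_mul]
    refine Finset.sum_congr rfl fun i _ => Finset.sum_congr rfl fun j _ => by ring
  · simp only [frob]
    push_cast
    simp_rw [mul_pow, Complex.I_sq, ← Finset.sum_mul]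
    simp_rw [pow_two]
    ring

/-- The density of the translate of `ginOE d` by `B`. -/
def shiftDensity {d : ℕ} (B : Matrix (Fin d) (Fin d) ℝ) (G : Fin d → Fin d → ℝ) : ℝ :=
  Real.exp (d * frob (Matrix.of G) B - d / 2 * frob B B)

lemma measurable_shiftDensity {d : ℕ} (B : Matrix (Fin d) (Fin d) ℝ) :
    Measurable (shiftDensity B) := by
  have := (continuous_frob_of B).measurable
  unfold shiftDensity
  fun_prop

/-- The Laplace transform of `ginOE d` at real arguments. -/
lemma lintegral_exp_frob_ginOE {d : ℕ} (hd : 1 ≤ d) (B : Matrix (Fin d) (Fin d) ℝ) :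
    ∫⁻ G, ENNReal.ofReal (Real.exp (d * frob (Matrix.of G) B)) ∂ginOE d
      = ENNReal.ofReal (Real.exp (d / 2 * frob B B)) := by
  have hd0 : (d : ℂ) ≠ 0 := by exact_mod_cast (by omega : d ≠ 0)
  have h := integral_cexp_ginOE (d := d) fun i j => d * B i j
  have e1 : ∀ G : Fin d → Fin d → ℝ, Complex.exp (∑ i, ∑ j, (d * B i j : ℂ) * G i j)
      = ((Real.exp (d * frob (Matrix.of G) B) : ℝ) : ℂ) := by
    intro G
    simp only [frob, Matrix.of_apply]
    push_cast
    simp_rw [Finset.mul_sum]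
    congr 1
    refine Finset.sum_congr rfl fun i _ => Finset.sum_congr rfl fun j _ => by ring
  have e2 : Complex.exp ((∑ i, ∑ j, (d * B i j : ℂ) ^ 2) / (2 * d))
      = ((Real.exp (d / 2 * frob B B) : ℝ) : ℂ) := by
    simp only [frob]
    push_cast
    simp_rw [mul_pow, ← Finset.mul_sum]
    congr 1
    field_simp
  simp_rw [e1] at h
  rw [e2, integral_complex_ofReal] at h
  have h' := Complex.ofReal_injective h
  rw [← h', ofReal_integral_eq_lintegral_ofReal]
  · by_contra hni
    rw [integral_undef hni] at h'
    exact (Real.exp_pos _).ne h'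
  · exact .of_forall fun _ => (Real.exp_pos _).le

lemma lintegral_shiftDensity {d : ℕ} (hd : 1 ≤ d) (B : Matrix (Fin d) (Fin d) ℝ) :
    ∫⁻ G, ENNReal.ofReal (shiftDensity B G) ∂ginOE d = 1 := by
  have : ∀ G, ENNReal.ofReal (shiftDensity B G)
      = ENNReal.ofReal (Real.exp (d * frob (Matrix.of G) B))
        * ENNReal.ofReal (Real.exp (-(d / 2 * frob B B))) := by
    intro G
    rw [← ENNReal.ofReal_mul (Real.exp_pos _).le, ← Real.exp_add, shiftDensity, sub_eq_add_neg]
  simp_rw [this]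
  rw [lintegral_mul_const' _ _ ENNReal.ofReal_ne_top, lintegral_exp_frob_ginOE hd,
    ← ENNReal.ofReal_mul (Real.exp_pos _).le, ← Real.exp_add]
  simp

/-- The Cameron–Martin formula for `ginOE d`. -/
lemma map_add_ginOE {d : ℕ} (hd : 1 ≤ d) (B : Fin d → Fin d → ℝ) :
    (ginOE d).map (fun G => G + B)
      = (ginOE d).withDensity fun G => ENNReal.ofReal (shiftDensity (Matrix.of B) G) := by
  have hd0 : (d : ℂ) ≠ 0 := by exact_mod_cast (by omega : d ≠ 0)
  have hm : Measurable fun G => ENNReal.ofReal (shiftDensity (Matrix.of B) G) :=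
    (measurable_shiftDensity _).ennreal_ofReal
  have : IsFiniteMeasure
      ((ginOE d).withDensity fun G => ENNReal.ofReal (shiftDensity (Matrix.of B) G)) :=
    isFiniteMeasure_withDensity (by rw [lintegral_shiftDensity hd]; simp)
  have : IsProbabilityMeasure ((ginOE d).map (fun G => G + B)) :=
    Measure.isProbabilityMeasure_map (by fun_prop)
  refine Measure.ext_of_charFunDual (funext fun L => ?_)
  obtain ⟨C, hC⟩ := exists_frob_eq L
  rw [charFunDual_apply, charFunDual_apply, integral_map (by fun_prop) (by fun_prop)]
  rw [integral_withDensity_eq_integral_toReal_smul hm (by simp)]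
  have e1 : ∀ G, Complex.exp (L (G + B) * Complex.I)
      = Complex.exp (frob (Matrix.of G) C * Complex.I)
        * Complex.exp (frob (Matrix.of B) C * Complex.I) := by
    intro G
    rw [map_add, hC, hC, ← Complex.exp_add]
    push_cast
    ring_nf
  have e2 : ∀ G, (ENNReal.ofReal (shiftDensity (Matrix.of B) G)).toReal
        • Complex.exp (L G * Complex.I)
      = Complex.exp (∑ i, ∑ j, (d * B i j + C i j * Complex.I : ℂ) * G i j)
        * Complex.exp (-(d / 2 * frob (Matrix.of B) (Matrix.of B))) := by
    intro G
    rw [shiftDensity, ENNReal.toReal_ofReal (Real.exp_pos _).le, hC, Complex.real_smul,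
      Complex.ofReal_exp, ← Complex.exp_add, ← Complex.exp_add]
    congr 1
    simp only [frob, Matrix.of_apply]
    push_cast
    simp_rw [add_mul, Finset.sum_add_distrib, Finset.mul_sum, Finset.sum_mul]
    rw [sub_add_eq_add_sub, sub_eq_add_neg]
    congr 2
    · refine Finset.sum_congr rfl fun i _ => Finset.sum_congr rfl fun j _ => by ring
    · refine Finset.sum_congr rfl fun i _ => Finset.sum_congr rfl fun j _ => by ring
  simp_rw [e1, e2]
  rw [integral_mul_const, integral_mul_const, integral_cexp_frob_ginOE, integral_cexp_ginOE,
    ← Complex.exp_add, ← Complex.exp_add]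
  congr 1
  simp only [frob, Matrix.of_apply]
  push_cast
  have e3 : ∀ i j, (d * B i j + C i j * Complex.I : ℂ) ^ 2
      = d ^ 2 * (B i j * B i j) + 2 * d * Complex.I * (B i j * C i j) - C i j * C i j := by
    intro i j
    ring_nf
    rw [Complex.I_sq]
    ring
  simp_rw [e3, Finset.sum_sub_distrib, Finset.sum_add_distrib, ← Finset.mul_sum]
  field_simp
  ring

lemma lintegral_add_ginOE {d : ℕ} (hd : 1 ≤ d) (B : Fin d → Fin d → ℝ)
    {f : (Fin d → Fin d → ℝ) → ℝ≥0∞} (hf : Measurable f) :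
    ∫⁻ G, f (G + B) ∂ginOE d
      = ∫⁻ G, f G * ENNReal.ofReal (shiftDensity (Matrix.of B) G) ∂ginOE d := by
  rw [← lintegral_map (f := f) (g := fun G => G + B) hf (by fun_prop), map_add_ginOE hd,
    lintegral_withDensity_eq_lintegral_mul _ (measurable_shiftDensity _).ennreal_ofReal hf]
  simp only [Pi.mul_apply, mul_comm]

/-- The matrix `G` with its compression to the range of the projection `R` replaced by that
of `G'`. -/
def resample {d : ℕ} (R : Matrix (Fin d) (Fin d) ℝ) (G G' : Fin d → Fin d → ℝ) :
    Fin d → Fin d → ℝ :=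
  Matrix.of.symm (Matrix.of G - R * Matrix.of G * R + R * Matrix.of G' * R)

lemma continuous_resample {d : ℕ} (R : Matrix (Fin d) (Fin d) ℝ) :
    Continuous fun x : (Fin d → Fin d → ℝ) × (Fin d → Fin d → ℝ) => resample R x.1 x.2 := by
  refine continuous_pi fun i => continuous_pi fun j => ?_
  simp only [resample, Matrix.of_symm_apply, Matrix.add_apply, Matrix.sub_apply, Matrix.mul_apply,
    Matrix.of_apply]
  fun_prop

/-- Replacing a fixed block of a Gaussian matrix by an independent copy does not change the law. -/
lemma map_resample_ginOE {d : ℕ} {R : Matrix (Fin d) (Fin d) ℝ} (hs : Rᵀ = R) (hi : R * R = R) :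
    ((ginOE d).prod (ginOE d)).map (fun x => resample R x.1 x.2) = ginOE d := by
  have hm := (continuous_resample R).measurable
  have : IsProbabilityMeasure (((ginOE d).prod (ginOE d)).map (fun x => resample R x.1 x.2)) :=
    Measure.isProbabilityMeasure_map hm.aemeasurable
  refine Measure.ext_of_charFunDual (funext fun L => ?_)
  obtain ⟨C, hC⟩ := exists_frob_eq L
  rw [charFunDual_apply, charFunDual_apply, integral_map hm.aemeasurable (by fun_prop)]
  have e1 : ∀ x : (Fin d → Fin d → ℝ) × (Fin d → Fin d → ℝ),
      Complex.exp (L (resample R x.1 x.2) * Complex.I)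
      = Complex.exp (frob (Matrix.of x.1) (C - R * C * R) * Complex.I)
        * Complex.exp (frob (Matrix.of x.2) (R * C * R) * Complex.I) := by
    intro x
    have : Matrix.of (resample R x.1 x.2)
      = Matrix.of x.1 - R * Matrix.of x.1 * R + R * Matrix.of x.2 * R := rfl
    rw [hC, this, frob_add_left, frob_sub_left, frob_compress _ _ hs, frob_compress _ _ hs,
      frob_sub_right, ← Complex.exp_add]
    push_cast
    ring_nf
  simp_rw [e1, hC]
  rw [integral_prod_mul (μ := ginOE d) (ν := ginOE d)
    (fun x => Complex.exp (frob (Matrix.of x) (C - R * C * R) * Complex.I))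
    (fun x => Complex.exp (frob (Matrix.of x) (R * C * R) * Complex.I))]
  rw [integral_cexp_frob_ginOE, integral_cexp_frob_ginOE, integral_cexp_frob_ginOE,
    ← Complex.exp_add]
  have h1 : frob (R * C * R) (R * C * R) = frob C (R * C * R) := by
    rw [frob_compress _ _ hs]
    congr 1
    calc R * (R * C * R) * R = (R * R) * C * (R * R) := by simp only [Matrix.mul_assoc]
      _ = _ := by rw [hi]
  rw [frob_sub_left, frob_sub_right, frob_sub_right, frob_comm (R * C * R) C, h1]
  congr 1
  push_cast
  ring

lemma lintegral_resample_ginOE {d : ℕ} {R : Matrix (Fin d) (Fin d) ℝ} (hs : Rᵀ = R)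
    (hi : R * R = R) {f : (Fin d → Fin d → ℝ) → ℝ≥0∞} (hf : Measurable f) :
    ∫⁻ G, f G ∂ginOE d = ∫⁻ G, ∫⁻ G', f (resample R G G') ∂ginOE d ∂ginOE d := by
  have hm := (continuous_resample R).measurable
  rw [← lintegral_prod (μ := ginOE d) (ν := ginOE d) (fun x => f (resample R x.1 x.2))
    (hf.comp hm).aemeasurable]
  conv_lhs => rw [← map_resample_ginOE hs hi, lintegral_map hf hm]

/-! ### Orthogonal projections, extended by one vector at a time -/

section Projections

/-- `P` is the matrix of an orthogonal projection. -/
structure IsOrthProj {d : ℕ} (P : Matrix (Fin d) (Fin d) ℝ) : Prop where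
  symm : Pᵀ = P
  idem : P * P = P

/-- If `P` is an orthogonal projection, the orthogonal projection onto the span of its range and
`v`. When `v` already lies in the range, `0⁻¹ = 0` makes this `P` itself. -/
def addProj {d : ℕ} (P : Matrix (Fin d) (Fin d) ℝ) (v : Fin d → ℝ) : Matrix (Fin d) (Fin d) ℝ :=
  P + ((v - P *ᵥ v) ⬝ᵥ (v - P *ᵥ v))⁻¹ • Matrix.vecMulVec (v - P *ᵥ v) (v - P *ᵥ v)

/-- The squared length of the projection of `u`, as a quadratic form. -/
def projSq {d : ℕ} (P : Matrix (Fin d) (Fin d) ℝ) (u : Fin d → ℝ) : ℝ := u ⬝ᵥ (P *ᵥ u)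

variable {d : ℕ} {P : Matrix (Fin d) (Fin d) ℝ}

namespace IsOrthProj

lemma zero : IsOrthProj (0 : Matrix (Fin d) (Fin d) ℝ) := ⟨by simp, by simp⟩

lemma compl (h : IsOrthProj P) : IsOrthProj (1 - P) :=
  ⟨by simp [h.symm], by simp [mul_sub, sub_mul, h.idem]⟩

lemma mulVec_resid (h : IsOrthProj P) (v : Fin d → ℝ) : P *ᵥ (v - P *ᵥ v) = 0 := by
  rw [Matrix.mulVec_sub, Matrix.mulVec_mulVec, h.idem, sub_self]

lemma resid_vecMul (h : IsOrthProj P) (v : Fin d → ℝ) : (v - P *ᵥ v) ᵥ* P = 0 := by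
  rw [← Matrix.mulVec_transpose, h.symm, h.mulVec_resid]

lemma mul_addProj (h : IsOrthProj P) (v : Fin d → ℝ) : P * addProj P v = P := by
  rw [addProj, mul_add, h.idem, Matrix.mul_smul, Matrix.mul_vecMulVec, h.mulVec_resid]
  simp

lemma addProj_mul (h : IsOrthProj P) (v : Fin d → ℝ) : addProj P v * P = P := by
  rw [addProj, add_mul, h.idem, Matrix.smul_mul, Matrix.vecMulVec_mul, h.resid_vecMul]
  simp

lemma addProj (h : IsOrthProj P) (v : Fin d → ℝ) : IsOrthProj (addProj P v) := by
  have hs : (TwoSideQuery.addProj P v)ᵀ = TwoSideQuery.addProj P v := by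
    simp [TwoSideQuery.addProj, h.symm, Matrix.transpose_vecMulVec]
  refine ⟨hs, ?_⟩
  conv_lhs => enter [2]; rw [TwoSideQuery.addProj]
  rw [mul_add, h.addProj_mul]
  conv_rhs => rw [TwoSideQuery.addProj]
  congr 1
  rw [Matrix.mul_smul, Matrix.mul_vecMulVec, TwoSideQuery.addProj, Matrix.add_mulVec,
    h.mulVec_resid, Matrix.smul_mulVec, Matrix.vecMulVec_mulVec]
  set q := v - P *ᵥ v
  by_cases hq : q ⬝ᵥ q = 0
  · simp [hq]
  · congr 2
    ext i
    simp [hq]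

lemma addProj_mulVec (h : IsOrthProj P) (v : Fin d → ℝ) : TwoSideQuery.addProj P v *ᵥ v = v := by
  have hq : (v - P *ᵥ v) ⬝ᵥ (P *ᵥ v) = 0 := by
    rw [Matrix.dotProduct_mulVec, h.resid_vecMul, zero_dotProduct]
  have e : (v - P *ᵥ v) ⬝ᵥ v = (v - P *ᵥ v) ⬝ᵥ (v - P *ᵥ v) := by
    rw [dotProduct_sub (v - P *ᵥ v) v, hq, sub_zero]
  rw [TwoSideQuery.addProj, Matrix.add_mulVec, Matrix.smul_mulVec, Matrix.vecMulVec_mulVec, e]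
  by_cases h0 : (v - P *ᵥ v) ⬝ᵥ (v - P *ᵥ v) = 0
  · rw [h0]
    rw [dotProduct_self_eq_zero, sub_eq_zero] at h0
    simp [← h0]
  · generalize P *ᵥ v = w at h0 ⊢
    ext i
    simp only [Pi.add_apply, Pi.smul_apply, MulOpposite.smul_eq_mul_unop, MulOpposite.unop_op,
      smul_eq_mul, Pi.sub_apply]
    rw [mul_comm (v i - w i), ← mul_assoc, inv_mul_cancel₀ h0]
    ring

/-- A vector in the range of `P` stays in the range of the extended projection. -/
lemma addProj_mulVec_of_mem (h : IsOrthProj P) (v : Fin d → ℝ) {w : Fin d → ℝ} (hw : P *ᵥ w = w) :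
    TwoSideQuery.addProj P v *ᵥ w = w := by
  rw [← hw, Matrix.mulVec_mulVec, h.addProj_mul]

lemma projSq_eq (h : IsOrthProj P) (u : Fin d → ℝ) : projSq P u = (P *ᵥ u) ⬝ᵥ (P *ᵥ u) := by
  rw [projSq, Matrix.dotProduct_mulVec (P *ᵥ u), Matrix.vecMul_mulVec, h.symm, h.idem,
    ← Matrix.dotProduct_mulVec]

lemma projSq_nonneg (h : IsOrthProj P) (u : Fin d → ℝ) : 0 ≤ projSq P u := by
  rw [h.projSq_eq]
  exact Finset.sum_nonneg fun i _ => mul_self_nonneg _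

lemma dotProduct_sq_le (h : IsOrthProj P) {v : Fin d → ℝ} (hv : P *ᵥ v = v) (hv1 : v ⬝ᵥ v = 1)
    (u : Fin d → ℝ) : (v ⬝ᵥ u) ^ 2 ≤ projSq P u := by
  have e : v ⬝ᵥ u = v ⬝ᵥ (P *ᵥ u) := by
    rw [Matrix.dotProduct_mulVec, ← Matrix.mulVec_transpose, h.symm, hv]
  rw [e, h.projSq_eq]
  have := Finset.sum_mul_sq_le_sq_mul_sq Finset.univ v (P *ᵥ u)
  simp only [dotProduct] at hv1 ⊢
  simp only [pow_two] at this ⊢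
  rwa [hv1, one_mul] at this

/-- Extending the projection by one vector multiplies `det (1 - c P)` by `1 - c`, or by `1` if the
vector is already in the range. -/
lemma det_addProj (h : IsOrthProj P) {c : ℝ} (hc0 : 0 ≤ c) (v : Fin d → ℝ)
    (hdet : 0 ≤ (1 - c • P).det) :
    (1 - c) * (1 - c • P).det ≤ (1 - c • TwoSideQuery.addProj P v).det := by
  set q := v - P *ᵥ v with hqdef
  set α := (q ⬝ᵥ q)⁻¹ with hα
  have hfac : 1 - c • TwoSideQuery.addProj P v
      = (1 - c • P) * (1 + Matrix.vecMulVec (-(c * α) • q) q) := by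
    rw [mul_add, mul_one, sub_mul, one_mul, Matrix.smul_mul, Matrix.mul_vecMulVec,
      Matrix.mulVec_smul, h.mulVec_resid, TwoSideQuery.addProj]
    simp only [← hqdef, ← hα, smul_zero, Matrix.zero_vecMulVec, sub_zero,
      smul_add, smul_smul]
    rw [Matrix.smul_vecMulVec, neg_smul]
    abel
  have hdet1 : (1 + Matrix.vecMulVec (-(c * α) • q) q).det = 1 - c * (α * (q ⬝ᵥ q)) := by
    rw [Matrix.vecMulVec_eq Unit, Matrix.det_one_add_replicateCol_mul_replicateRow]
    simp only [dotProduct_smul, smul_eq_mul]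
    ring
  rw [hfac, Matrix.det_mul, hdet1, mul_comm]
  refine mul_le_mul_of_nonneg_left ?_ hdet
  by_cases h0 : q ⬝ᵥ q = 0
  · simp [h0, hc0]
  · rw [hα, inv_mul_cancel₀ h0, mul_one]

lemma dotProduct_one_sub_smul (h : IsOrthProj P) (c : ℝ) (u : Fin d → ℝ) :
    ((1 - c • P) *ᵥ u) ⬝ᵥ ((1 - c • P) *ᵥ u) = u ⬝ᵥ u - (2 * c - c ^ 2) * projSq P u := by
  have e : (P *ᵥ u) ⬝ᵥ u = projSq P u := by rw [dotProduct_comm, projSq]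
  rw [Matrix.sub_mulVec, Matrix.one_mulVec, Matrix.smul_mulVec, sub_dotProduct, dotProduct_sub,
    dotProduct_sub, smul_dotProduct, smul_dotProduct, dotProduct_smul, dotProduct_smul,
    ← h.projSq_eq, e, ← projSq]
  simp only [smul_eq_mul]
  ring

end IsOrthProj

/-- For `B = c • a bᵀ` with unit vectors `a`, `b`, the part of `B` outside of the compression by
`1 - P` is controlled by the projections of `a` and `b` to the range of `P`. -/
lemma frob_vecMulVec_sub_compress_le (h : IsOrthProj P) (c : ℝ) {a b : Fin d → ℝ}
    (ha : a ⬝ᵥ a = 1) (hb : b ⬝ᵥ b = 1) :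
    frob (c • Matrix.vecMulVec a b) (c • Matrix.vecMulVec a b)
      - frob ((1 - P) * (c • Matrix.vecMulVec a b) * (1 - P))
          ((1 - P) * (c • Matrix.vecMulVec a b) * (1 - P))
      ≤ c ^ 2 * (projSq P a + projSq P b) := by
  have key : ∀ x y : Fin d → ℝ, frob (c • Matrix.vecMulVec x y) (c • Matrix.vecMulVec x y)
      = c ^ 2 * ((x ⬝ᵥ x) * (y ⬝ᵥ y)) := by
    intro x y
    simp only [frob, Matrix.smul_apply, Matrix.vecMulVec_apply, dotProduct, smul_eq_mul,
      Finset.sum_mul_sum]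
    simp only [Finset.mul_sum]
    refine Finset.sum_congr rfl fun i _ => Finset.sum_congr rfl fun j _ => by ring
  have e : (1 - P) * (c • Matrix.vecMulVec a b) * (1 - P)
      = c • Matrix.vecMulVec ((1 - P) *ᵥ a) ((1 - P) *ᵥ b) := by
    rw [Matrix.mul_smul, Matrix.smul_mul, Matrix.mul_vecMulVec, Matrix.vecMulVec_mul,
      ← Matrix.mulVec_transpose, h.compl.symm]
  have n : ∀ x : Fin d → ℝ, ((1 - P) *ᵥ x) ⬝ᵥ ((1 - P) *ᵥ x) = x ⬝ᵥ x - projSq P x := by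
    intro x
    have := h.dotProduct_one_sub_smul 1 x
    rw [one_smul] at this
    rw [this]; ring
  rw [e, key, key, n, n, ha, hb]
  nlinarith [mul_nonneg (sq_nonneg c) (mul_nonneg (h.projSq_nonneg a) (h.projSq_nonneg b))]

end Projections

/-! ### Exponential moments of projections of a uniform unit vector -/

/-- In polar coordinates, the volume of the ellipsoid `{x | ‖f x‖ < 1}` is an integral over the
unit sphere. -/
lemma lintegral_toSphere_inv_norm_pow {E : Type*} [NormedAddCommGroup E] [NormedSpace ℝ E]
    [MeasurableSpace E] [BorelSpace E] [FiniteDimensional ℝ E] [Nontrivial E] (μ : Measure E)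
    [μ.IsAddHaarMeasure] (f : E →ₗ[ℝ] E) (hf : LinearMap.det f ≠ 0) :
    ∫⁻ u : Metric.sphere (0 : E) 1, ENNReal.ofReal (‖f u‖⁻¹ ^ Module.finrank ℝ E) ∂μ.toSphere
      = ENNReal.ofReal |(LinearMap.det f)⁻¹| * μ.toSphere Set.univ := by
  set n := Module.finrank ℝ E with hn
  have hn0 : 0 < n := Module.finrank_pos
  have hcont : Continuous f := f.continuous_of_finiteDimensional
  have hinj : ∀ x, f x = 0 → x = 0 := fun x hx =>
    (f.equivOfDetNeZero hf).injective (by simpa using hx)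
  have hpos : ∀ u : Metric.sphere (0 : E) 1, 0 < ‖f u‖ := fun u =>
    norm_pos_iff.2 fun h => Metric.ne_of_mem_sphere u.2 one_ne_zero (hinj _ h)
  set S : Set (Metric.sphere (0 : E) 1 × Set.Ioi (0 : ℝ)) := {x | x.2.1 * ‖f x.1‖ < 1} with hS
  have hSm : MeasurableSet S := by
    refine (isOpen_lt ?_ continuous_const).measurableSet
    fun_prop
  have h1 : (μ.toSphere.prod (Measure.volumeIoiPow (n - 1))) S
      = ∫⁻ u : Metric.sphere (0 : E) 1, ENNReal.ofReal (‖f u‖⁻¹ ^ n / n) ∂μ.toSphere := by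
    rw [Measure.prod_apply hSm]
    refine lintegral_congr fun u => ?_
    have : Prod.mk u ⁻¹' S = Set.Iio (⟨‖f u‖⁻¹, inv_pos.2 (hpos u)⟩ : Set.Ioi (0 : ℝ)) := by
      ext r
      simp only [hS, Set.mem_preimage, Set.mem_ofPred_eq, Set.mem_Iio, ← Subtype.coe_lt_coe]
      rw [lt_inv_comm₀ r.2 (hpos u), ← one_div, lt_div_iff₀ r.2, mul_comm]
    rw [this, Measure.volumeIoiPow_apply_Iio, Nat.sub_add_cancel hn0, Nat.cast_pred hn0,
      sub_add_cancel]
  have h2 : (μ.toSphere.prod (Measure.volumeIoiPow (n - 1))) S = μ (f ⁻¹' Metric.ball 0 1) := by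
    rw [← (μ.measurePreserving_homeomorphUnitSphereProd).measure_preimage hSm.nullMeasurableSet,
      comap_subtype_coe_apply (measurableSet_singleton _).compl]
    have : (Subtype.val '' (homeomorphUnitSphereProd E ⁻¹' S)) = f ⁻¹' Metric.ball 0 1 \ {0} := by
      ext x
      simp only [Set.mem_image, Set.mem_preimage, Set.mem_sdiff, Set.mem_singleton_iff,
        mem_ball_zero_iff, Subtype.exists, Set.mem_compl_iff, exists_and_left, hS,
        Set.mem_ofPred_eq, homeomorphUnitSphereProd_apply_fst_coe,
        homeomorphUnitSphereProd_apply_snd_coe, map_smul, norm_smul, norm_inv, norm_norm]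
      constructor
      · rintro ⟨y, hy, h0, rfl⟩
        exact ⟨by rwa [← mul_assoc, mul_inv_cancel₀ (norm_ne_zero_iff.2 h0), one_mul] at hy, h0⟩
      · rintro ⟨hx, h0⟩
        exact ⟨x, by rwa [← mul_assoc, mul_inv_cancel₀ (norm_ne_zero_iff.2 h0), one_mul], h0, rfl⟩
    rw [this, measure_sdiff_null (measure_singleton _)]
  rw [h2, Measure.addHaar_preimage_linearMap μ hf] at h1
  have hnE : (n : ℝ≥0∞) ≠ 0 := by simpa using hn0.ne'
  calc ∫⁻ u : Metric.sphere (0 : E) 1, ENNReal.ofReal (‖f u‖⁻¹ ^ n) ∂μ.toSphere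
      = n * ∫⁻ u : Metric.sphere (0 : E) 1, ENNReal.ofReal (‖f u‖⁻¹ ^ n / n) ∂μ.toSphere := by
        rw [← lintegral_const_mul' _ _ (by simp)]
        refine lintegral_congr fun u => ?_
        rw [ENNReal.ofReal_div_of_pos (by positivity), ENNReal.ofReal_natCast,
          ENNReal.mul_div_cancel hnE (by simp)]
    _ = _ := by
        rw [← h1, Measure.toSphere_apply_univ]
        ring

lemma isProbabilityMeasure_uniformSphere {d : ℕ} (hd : 1 ≤ d) :
    IsProbabilityMeasure (uniformSphere d) := by
  have : Nontrivial (EuclideanSpace ℝ (Fin d)) :=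
    Module.nontrivial_of_finrank_pos (R := ℝ) (by simp; omega)
  refine ⟨?_⟩
  rw [uniformSphere, Measure.smul_apply, smul_eq_mul]
  exact ENNReal.inv_mul_cancel (by simp [-Measure.toSphere_apply_univ]) (measure_ne_top _ _)

lemma continuous_projSq {d : ℕ} (P : Matrix (Fin d) (Fin d) ℝ) :
    Continuous fun u : UnitSphere d => projSq P u.1.ofLp := by
  unfold projSq
  fun_prop

lemma UnitSphere.dotProduct_self {d : ℕ} (u : UnitSphere d) : u.1.ofLp ⬝ᵥ u.1.ofLp = 1 := by
  have h : ‖u.1‖ = 1 := by simp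
  have := EuclideanSpace.real_norm_sq_eq u.1
  rw [h] at this
  simp only [dotProduct, ← pow_two]
  linarith

/-- A uniform unit vector has at most the exponential moments of a Gaussian vector with the same
covariance. If the projection `P` has rank `m`, the determinant below is `δ ^ m`. The proof evaluates
the volume of the ellipsoid `{x | ‖(1 - (1 - δ) P) x‖ < 1}`. -/
lemma lintegral_exp_projSq_le {d : ℕ} (hd : 1 ≤ d) {P : Matrix (Fin d) (Fin d) ℝ}
    (hP : IsOrthProj P) {δ b : ℝ} (hb : 0 < b)
    (hdet : b ≤ (1 - (1 - δ) • P).det) :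
    ∫⁻ u, ENNReal.ofReal (Real.exp ((1 - δ ^ 2) / 2 * d * projSq P u.1.ofLp)) ∂uniformSphere d
      ≤ ENNReal.ofReal b⁻¹ := by
  have : Nontrivial (EuclideanSpace ℝ (Fin d)) :=
    Module.nontrivial_of_finrank_pos (R := ℝ) (by simp; omega)
  set A := 1 - (1 - δ) • P with hA
  set f := Matrix.toEuclideanLin A with hfdef
  have hdetf : LinearMap.det f = A.det := by
    have : f = Matrix.toLin (PiLp.basisFun 2 ℝ (Fin d)) (PiLp.basisFun 2 ℝ (Fin d)) A := by
      rw [hfdef, Matrix.toEuclideanLin, Matrix.toLpLin_eq_toLin]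
    rw [this, LinearMap.det_toLin]
  have hdet0 : 0 < A.det := hb.trans_le hdet
  have hf : LinearMap.det f ≠ 0 := by rw [hdetf]; exact hdet0.ne'
  have hpt : ∀ u : UnitSphere d,
      Real.exp ((1 - δ ^ 2) / 2 * d * projSq P u.1.ofLp) ≤ ‖f u‖⁻¹ ^ d := by
    intro u
    have hn : ‖f u‖ ^ 2 = 1 - (1 - δ ^ 2) * projSq P u.1.ofLp := by
      have e : ‖f u‖ ^ 2 = (A *ᵥ u.1.ofLp) ⬝ᵥ (A *ᵥ u.1.ofLp) := by
        rw [EuclideanSpace.real_norm_sq_eq]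
        simp only [dotProduct, ← pow_two]
        rfl
      rw [e, hP.dotProduct_one_sub_smul, UnitSphere.dotProduct_self]
      ring
    have hne : 0 < ‖f u‖ := norm_pos_iff.2 fun h =>
      Metric.ne_of_mem_sphere u.2 one_ne_zero ((f.equivOfDetNeZero hf).injective (by simpa using h))
    have hle : ‖f u‖ ≤ Real.exp (-((1 - δ ^ 2) / 2 * projSq P u.1.ofLp)) := by
      refine le_of_sq_le_sq ?_ (Real.exp_pos _).le
      rw [hn, ← Real.exp_nat_mul]
      have := Real.add_one_le_exp (-((1 - δ ^ 2) * projSq P u.1.ofLp))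
      refine le_trans (by linarith) (this.trans (le_of_eq ?_))
      congr 1; push_cast; ring
    calc Real.exp ((1 - δ ^ 2) / 2 * d * projSq P u.1.ofLp)
        = ((Real.exp (-((1 - δ ^ 2) / 2 * projSq P u.1.ofLp)))⁻¹) ^ d := by
          rw [← Real.exp_neg, neg_neg, ← Real.exp_nat_mul]; congr 1; ring
      _ ≤ _ := by gcongr
  have key := lintegral_toSphere_inv_norm_pow
    (volume : Measure (EuclideanSpace ℝ (Fin d))) f hf
  rw [finrank_euclideanSpace_fin, hdetf] at key
  rw [uniformSphere, lintegral_smul_measure, smul_eq_mul]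
  calc _ ≤ _ * ∫⁻ u : UnitSphere d, ENNReal.ofReal (‖f u‖⁻¹ ^ d)
          ∂(volume : Measure (EuclideanSpace ℝ (Fin d))).toSphere := by
        gcongr with u
        exact hpt u
    _ = ENNReal.ofReal |A.det⁻¹| := by
        rw [key, mul_left_comm, ENNReal.inv_mul_cancel
          (by simp [-Measure.toSphere_apply_univ]) (measure_ne_top _ _), mul_one]
    _ ≤ ENNReal.ofReal b⁻¹ := by
        apply ENNReal.ofReal_le_ofReal
        rw [abs_of_pos (inv_pos.2 hdet0)]
        exact inv_anti₀ hb hdet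

/-- The exponential moment of the total projection of two independent uniform unit vectors. -/
lemma lintegral_exp_projSq_add_le {d : ℕ} (hd : 1 ≤ d) {P : Matrix (Fin d) (Fin d) ℝ}
    (hP : IsOrthProj P) {δ b : ℝ} (hb : 0 < b) (hdet : b ≤ (1 - (1 - δ) • P).det) :
    ∫⁻ u, ENNReal.ofReal (Real.exp ((1 - δ ^ 2) / 2 * d
        * (projSq P u.1.1.ofLp + projSq P u.2.1.ofLp)))
          ∂(uniformSphere d).prod (uniformSphere d)
      ≤ ENNReal.ofReal (b⁻¹ ^ 2) := by
  have := isProbabilityMeasure_uniformSphere hd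
  have hm : Measurable fun u : UnitSphere d =>
      ENNReal.ofReal (Real.exp ((1 - δ ^ 2) / 2 * d * projSq P u.1.ofLp)) := by
    have := (continuous_projSq P).measurable
    fun_prop
  simp_rw [mul_add, Real.exp_add, ENNReal.ofReal_mul (Real.exp_pos _).le]
  rw [lintegral_prod_mul hm.aemeasurable hm.aemeasurable, pow_two b⁻¹,
    ENNReal.ofReal_mul (inv_pos.2 hb).le]
  exact mul_le_mul' (lintegral_exp_projSq_le hd hP hb hdet) (lintegral_exp_projSq_le hd hP hb hdet)

/-! ### Histories, and resampling of the unobserved block -/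

section History

/-- The orthogonal projection extended by the real and imaginary parts of a complex vector. -/
def addProjC {d : ℕ} (P : Matrix (Fin d) (Fin d) ℝ) (v : Fin d → ℂ) : Matrix (Fin d) (Fin d) ℝ :=
  addProj (addProj P fun i => (v i).re) fun i => (v i).im

/-- The orthogonal projection of `ℝ^d` onto the span of the real and imaginary parts of the
queries in a history. -/
def histProj {d : ℕ} : (k : ℕ) → (Fin k → Triple d) → Matrix (Fin d) (Fin d) ℝ
  | 0, _ => 0
  | k + 1, h => addProjC (histProj k (Fin.init h)) (h (Fin.last k)).1

section Projections

variable {d : ℕ} {P : Matrix (Fin d) (Fin d) ℝ}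

lemma IsOrthProj.addProjC (h : IsOrthProj P) (v : Fin d → ℂ) :
    IsOrthProj (addProjC P v) := (h.addProj _).addProj _

lemma IsOrthProj.mul_addProjC (h : IsOrthProj P) (v : Fin d → ℂ) :
    P * TwoSideQuery.addProjC P v = P := by
  have hQ := h.addProj fun i => (v i).re
  have hPQ := h.mul_addProj fun i => (v i).re
  rw [TwoSideQuery.addProjC]
  generalize (TwoSideQuery.addProj P fun i => (v i).re) = Q at hQ hPQ ⊢
  nth_rewrite 1 [← hPQ]
  rw [Matrix.mul_assoc, hQ.mul_addProj, hPQ]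

lemma IsOrthProj.addProjC_mul (h : IsOrthProj P) (v : Fin d → ℂ) :
    TwoSideQuery.addProjC P v * P = P := by
  have := congrArg Matrix.transpose (h.mul_addProjC v)
  rwa [Matrix.transpose_mul, (h.addProjC v).symm, h.symm] at this

lemma IsOrthProj.addProjC_mulVec_re (h : IsOrthProj P) (v : Fin d → ℂ) :
    TwoSideQuery.addProjC P v *ᵥ (fun i => (v i).re) = fun i => (v i).re :=
  (h.addProj _).addProj_mulVec_of_mem _ (h.addProj_mulVec _)

lemma IsOrthProj.addProjC_mulVec_im (h : IsOrthProj P) (v : Fin d → ℂ) :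
    TwoSideQuery.addProjC P v *ᵥ (fun i => (v i).im) = fun i => (v i).im :=
  (h.addProj _).addProj_mulVec _

lemma IsOrthProj.det_addProjC (h : IsOrthProj P) {δ b : ℝ} (hδ0 : 0 ≤ δ) (hδ1 : δ ≤ 1)
    (hb : 0 ≤ b) (hdet : b ≤ (1 - (1 - δ) • P).det) (v : Fin d → ℂ) :
    δ ^ 2 * b ≤ (1 - (1 - δ) • TwoSideQuery.addProjC P v).det := by
  have h1 := h.det_addProj (sub_nonneg.2 hδ1) (fun i => (v i).re) (hb.trans hdet)
  have h0 : 0 ≤ (1 - (1 - δ)) * (1 - (1 - δ) • P).det :=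
    mul_nonneg (by linarith) (hb.trans hdet)
  have h2 := (h.addProj _).det_addProj (sub_nonneg.2 hδ1) (fun i => (v i).im) (h0.trans h1)
  rw [sub_sub_cancel] at h1 h2
  calc δ ^ 2 * b = δ * (δ * b) := by ring
    _ ≤ δ * (δ * (1 - (1 - δ) • P).det) := by gcongr
    _ ≤ δ * _ := by gcongr
    _ ≤ _ := h2

lemma isOrthProj_histProj (k : ℕ) (h : Fin k → Triple d) : IsOrthProj (histProj k h) := by
  induction k with
  | zero => exact .zero
  | succ k ih => exact (ih _).addProjC _

/-- The determinant encodes that each query adds at most two dimensions. -/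
lemma le_det_histProj {δ : ℝ} (hδ0 : 0 ≤ δ) (hδ1 : δ ≤ 1) (k : ℕ) (h : Fin k → Triple d) :
    δ ^ (2 * k) ≤ (1 - (1 - δ) • histProj k h).det := by
  induction k with
  | zero => simp [histProj]
  | succ k ih =>
    have := (isOrthProj_histProj k (Fin.init h)).det_addProjC hδ0 hδ1 (by positivity)
      (ih (Fin.init h)) (h (Fin.last k)).1
    rw [← pow_add] at this
    rwa [show 2 * (k + 1) = 2 + 2 * k by ring]

end Projections

section Measurability

variable {d : ℕ} {X : Type*} [MeasurableSpace X]

lemma measurable_addProj {P : X → Matrix (Fin d) (Fin d) ℝ} {v : X → Fin d → ℝ}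
    (hP : ∀ i j, Measurable fun x => P x i j) (hv : ∀ i, Measurable fun x => v x i) (i j : Fin d) :
    Measurable fun x => addProj (P x) (v x) i j := by
  simp only [addProj, Matrix.add_apply, Matrix.smul_apply, Matrix.vecMulVec_apply, dotProduct,
    Matrix.mulVec, Pi.sub_apply, smul_eq_mul]
  fun_prop

lemma measurable_addProjC {P : X → Matrix (Fin d) (Fin d) ℝ} {v : X → Fin d → ℂ}
    (hP : ∀ i j, Measurable fun x => P x i j) (hv : Measurable v) (i j : Fin d) :
    Measurable fun x => addProjC (P x) (v x) i j := by
  refine measurable_addProj (fun i j => measurable_addProj hP (fun i => ?_) i j) (fun i => ?_) i j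
  · exact Complex.measurable_re.comp (measurable_pi_iff.1 hv i)
  · exact Complex.measurable_im.comp (measurable_pi_iff.1 hv i)

lemma measurable_histProj (k : ℕ) (i j : Fin d) :
    Measurable fun h : Fin k → Triple d => histProj k h i j := by
  induction k generalizing i j with
  | zero => simp [histProj]
  | succ k ih =>
    refine measurable_addProjC (fun i j => (ih i j).comp ?_) (by fun_prop) i j
    exact measurable_pi_iff.2 fun a => measurable_pi_apply _

lemma measurable_resample {R : X → Matrix (Fin d) (Fin d) ℝ} {G G' : X → Fin d → Fin d → ℝ}
    (hR : ∀ i j, Measurable fun x => R x i j) (hG : Measurable G) (hG' : Measurable G') :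
    Measurable fun x => resample (R x) (G x) (G' x) := by
  refine measurable_pi_iff.2 fun i => measurable_pi_iff.2 fun j => ?_
  simp only [resample, Matrix.of_symm_apply, Matrix.add_apply, Matrix.sub_apply, Matrix.mul_apply,
    Matrix.of_apply]
  fun_prop

lemma measurable_answer {G : X → Fin d → Fin d → ℝ} {v : X → Fin d → ℂ} (hG : Measurable G)
    (hv : Measurable v) : Measurable fun x => answer (Matrix.of (G x)) (v x) := by
  refine hv.prodMk (Measurable.prodMk ?_ ?_) <;> refine measurable_pi_iff.2 fun i => ?_
  · simp only [Matrix.mulVec, dotProduct, Matrix.map_apply, Matrix.of_apply]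
    fun_prop
  · simp only [Matrix.mulVec, dotProduct, Matrix.map_apply, Matrix.of_apply,
      Matrix.conjTranspose_apply, Complex.star_def, Complex.conj_ofReal]
    fun_prop

lemma measurable_snoc {k : ℕ} {h : X → Fin k → Triple d} {t : X → Triple d} (hh : Measurable h)
    (ht : Measurable t) :
    Measurable fun x => (Fin.snoc (α := fun _ => Triple d) (h x) (t x) : Fin (k + 1) → Triple d) :=
  measurable_pi_iff.2 fun i => by
    induction i using Fin.lastCases with
    | last => simpa using ht
    | cast i => simpa using measurable_pi_iff.1 hh i

variable {T : ℕ} {R : Type*} [MeasurableSpace R]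

lemma Algorithm.measurable_history (A : Algorithm d T R) (k : ℕ) {r : X → R}
    {G : X → Fin d → Fin d → ℝ} (hr : Measurable r) (hG : Measurable G) :
    Measurable fun x => A.history (Matrix.of (G x)) (r x) k := by
  induction k with
  | zero => exact measurable_const
  | succ k ih =>
    exact measurable_snoc ih (measurable_answer hG ((A.measurable_query k).comp (hr.prodMk ih)))

end Measurability

variable {d T : ℕ} {R : Type*} [MeasurableSpace R]

lemma map_ofReal_mulVec (M : Matrix (Fin d) (Fin d) ℝ) (v : Fin d → ℂ) (i : Fin d) :
    (M.map Complex.ofReal *ᵥ v) i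
      = ((M *ᵥ fun i => (v i).re) i : ℂ) + ((M *ᵥ fun i => (v i).im) i : ℂ) * Complex.I := by
  simp only [Matrix.mulVec, dotProduct, Matrix.map_apply, Complex.ofReal_sum, Complex.ofReal_mul,
    Finset.sum_mul, ← Finset.sum_add_distrib]
  refine Finset.sum_congr rfl fun j _ => ?_
  conv_lhs => rw [← Complex.re_add_im (v j)]
  ring

/-- The answer to a query does not depend on the block of the matrix orthogonal to the query. -/
lemma answer_resample {P : Matrix (Fin d) (Fin d) ℝ} (hP : IsOrthProj P) {v : Fin d → ℂ}
    (hre : P *ᵥ (fun i => (v i).re) = fun i => (v i).re)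
    (him : P *ᵥ (fun i => (v i).im) = fun i => (v i).im) (G G' : Fin d → Fin d → ℝ) :
    answer (Matrix.of (resample (1 - P) G G')) v = answer (Matrix.of G) v := by
  have h1 : ∀ (N : Matrix (Fin d) (Fin d) ℝ) (w : Fin d → ℝ), P *ᵥ w = w →
      ((1 - P) * N * (1 - P)) *ᵥ w = 0 := by
    intro N w hw
    rw [← Matrix.mulVec_mulVec, Matrix.sub_mulVec, hw]
    simp
  have hM : Matrix.of (resample (1 - P) G G')
      = Matrix.of G - (1 - P) * Matrix.of G * (1 - P) + (1 - P) * Matrix.of G' * (1 - P) := rfl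
  have hMt : (Matrix.of (resample (1 - P) G G'))ᵀ
      = (Matrix.of G)ᵀ - (1 - P) * (Matrix.of G)ᵀ * (1 - P)
        + (1 - P) * (Matrix.of G')ᵀ * (1 - P) := by
    rw [hM]
    simp only [Matrix.transpose_add, Matrix.transpose_sub, Matrix.transpose_mul, hP.compl.symm,
      Matrix.mul_assoc]
  have hc : ∀ N : Matrix (Fin d) (Fin d) ℝ, (N.map Complex.ofReal)ᴴ = Nᵀ.map Complex.ofReal := by
    intro N; ext; simp
  unfold answer
  rw [hc, hc]
  congr 2 <;> ext i
  · rw [map_ofReal_mulVec, map_ofReal_mulVec, hM]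
    simp only [Matrix.add_mulVec, Matrix.sub_mulVec _ _ (fun i => (v i).re),
      Matrix.sub_mulVec _ _ (fun i => (v i).im), h1 _ _ hre, h1 _ _ him, sub_zero, add_zero]
  · rw [map_ofReal_mulVec, map_ofReal_mulVec, hMt]
    simp only [Matrix.add_mulVec, Matrix.sub_mulVec _ _ (fun i => (v i).re),
      Matrix.sub_mulVec _ _ (fun i => (v i).im), h1 _ _ hre, h1 _ _ him, sub_zero, add_zero]

lemma resample_resample {R R' : Matrix (Fin d) (Fin d) ℝ} (h1 : R * R' = R') (h2 : R' * R = R')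
    (G G' G'' : Fin d → Fin d → ℝ) :
    resample R G (resample R' G' G'') = resample R' (resample R G G') G'' := by
  have e : ∀ N : Matrix (Fin d) (Fin d) ℝ, R * (R' * N * R') * R = R' * N * R' := by
    intro N
    rw [Matrix.mul_assoc R' N R', ← Matrix.mul_assoc R R', h1, Matrix.mul_assoc, Matrix.mul_assoc,
      h2]
  have e' : ∀ N : Matrix (Fin d) (Fin d) ℝ, R' * (R * N * R) * R' = R' * N * R' := by
    intro N
    rw [Matrix.mul_assoc R N R, ← Matrix.mul_assoc R' R, h2, Matrix.mul_assoc, Matrix.mul_assoc,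
      h1, Matrix.mul_assoc]
  apply Matrix.of.injective
  simp only [resample, Equiv.apply_symm_apply, mul_add, mul_sub, add_mul, sub_mul, e, e']
  abel

/-- Conditionally on the history, the block of `G` orthogonal to the queries is still a Gaussian
block, independent of the observed part of `G`. -/
lemma Algorithm.lintegral_history_resample (A : Algorithm d T R) (r : R) (k : ℕ)
    {f : (Fin k → Triple d) × (Fin d → Fin d → ℝ) → ℝ≥0∞} (hf : Measurable f) :
    ∫⁻ G, f (A.history (Matrix.of G) r k, G) ∂ginOE d
      = ∫⁻ G, ∫⁻ G', f (A.history (Matrix.of G) r k,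
          resample (1 - histProj k (A.history (Matrix.of G) r k)) G G') ∂ginOE d ∂ginOE d := by
  induction k with
  | zero =>
    have e : ∀ G G' : Fin d → Fin d → ℝ,
        resample (1 - histProj 0 (A.history (Matrix.of G) r 0)) G G' = G' := by
      intro G G'
      apply Matrix.of.injective
      simp [resample, histProj]
    simp_rw [e]
    simp only [Algorithm.history]
    rw [lintegral_const, measure_univ, mul_one]
  | succ k ih =>
    have hq : Measurable fun h : Fin k → Triple d => A.query k r h :=
      (A.measurable_query k).comp measurable_prodMk_left
    let next : (Fin k → Triple d) → (Fin d → Fin d → ℝ) → (Fin (k + 1) → Triple d) := fun h G =>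
      Fin.snoc (α := fun _ => Triple d) h (answer (Matrix.of G) (A.query k r h))
    have hnext : Measurable fun x : (Fin k → Triple d) × (Fin d → Fin d → ℝ) => next x.1 x.2 :=
      measurable_snoc measurable_fst (measurable_answer measurable_snd (hq.comp measurable_fst))
    let P' : (Fin k → Triple d) → Matrix (Fin d) (Fin d) ℝ := fun h =>
      addProjC (histProj k h) (A.query k r h)
    have hP' : ∀ h, IsOrthProj (P' h) := fun h => (isOrthProj_histProj k h).addProjC _
    have hP'm : ∀ i j, Measurable fun h => (1 - P' h) i j := fun i j =>
      measurable_const.sub (measurable_addProjC (measurable_histProj k) hq i j)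
    have hproj : ∀ h G, histProj (k + 1) (next h G) = P' h := by
      intro h G
      simp [next, P', histProj, answer]
    let f1 : (Fin k → Triple d) × (Fin d → Fin d → ℝ) → ℝ≥0∞ := fun x => f (next x.1 x.2, x.2)
    have hf1 : Measurable f1 := hf.comp (hnext.prodMk measurable_snd)
    let f3 : (Fin k → Triple d) × (Fin d → Fin d → ℝ) → ℝ≥0∞ := fun x =>
      ∫⁻ G'', f (next x.1 x.2, resample (1 - P' x.1) x.2 G'') ∂ginOE d
    have hf3 : Measurable f3 := by
      refine Measurable.lintegral_prod_right' (f := fun y :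
        ((Fin k → Triple d) × (Fin d → Fin d → ℝ)) × (Fin d → Fin d → ℝ) =>
          f (next y.1.1 y.1.2, resample (1 - P' y.1.1) y.1.2 y.2)) (hf.comp (Measurable.prodMk ?_ ?_))
      · exact hnext.comp measurable_fst
      · exact measurable_resample (fun i j => (hP'm i j).comp (by fun_prop)) (by fun_prop)
          (by fun_prop)
    have step : ∀ h G, ∫⁻ G', f1 (h, resample (1 - histProj k h) G G') ∂ginOE d
        = ∫⁻ G', f3 (h, resample (1 - histProj k h) G G') ∂ginOE d := by
      intro h G
      have hR := isOrthProj_histProj k h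
      have hm : Measurable fun G' => f1 (h, resample (1 - histProj k h) G G') := by
        refine hf1.comp (measurable_const.prodMk ?_)
        exact measurable_resample (fun i j => measurable_const) measurable_const measurable_id
      rw [lintegral_resample_ginOE (hP' h).compl.symm (hP' h).compl.idem hm]
      refine lintegral_congr fun G' => lintegral_congr fun G'' => ?_
      have hRR : (1 - histProj k h) * (1 - P' h) = 1 - P' h := by
        rw [sub_mul, one_mul, mul_sub, mul_one, hR.mul_addProjC]; simp
      have hRR' : (1 - P' h) * (1 - histProj k h) = 1 - P' h := by
        rw [mul_sub, mul_one, sub_mul, one_mul, hR.addProjC_mul]; simp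
      rw [resample_resample hRR hRR']
      simp only [f1, next]
      rw [answer_resample (hP' h) (hR.addProjC_mulVec_re _) (hR.addProjC_mulVec_im _)]
    calc ∫⁻ G, f (A.history (Matrix.of G) r (k + 1), G) ∂ginOE d
        = ∫⁻ G, f1 (A.history (Matrix.of G) r k, G) ∂ginOE d := rfl
      _ = ∫⁻ G, f3 (A.history (Matrix.of G) r k, G) ∂ginOE d := by
          rw [ih hf1, ih hf3]
          exact lintegral_congr fun G => step _ _
      _ = _ := by
          refine lintegral_congr fun G => lintegral_congr fun G' => ?_
          have : A.history (Matrix.of G) r (k + 1) = next (A.history (Matrix.of G) r k) G := rfl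
          rw [this, hproj]

/-- The likelihood ratio of the observations for the matrices `G + B` and `G`, when the queries
span the range of `P`. -/
def likelihood (P B : Matrix (Fin d) (Fin d) ℝ) (G : Fin d → Fin d → ℝ) : ℝ :=
  Real.exp (d * frob (Matrix.of G - (1 - P) * Matrix.of G * (1 - P)) B
    - d / 2 * (frob B B - frob ((1 - P) * B * (1 - P)) ((1 - P) * B * (1 - P))))

lemma likelihood_nonneg (P B : Matrix (Fin d) (Fin d) ℝ) (G : Fin d → Fin d → ℝ) :
    0 ≤ likelihood P B G := (Real.exp_pos _).le

/-- A change of measure on the level of histories. -/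
lemma Algorithm.lintegral_history_add (hd : 1 ≤ d) (A : Algorithm d T R) (r : R) (k : ℕ)
    (B : Fin d → Fin d → ℝ) {f : (Fin k → Triple d) → ℝ≥0∞} (hf : Measurable f) :
    ∫⁻ G, f (A.history (Matrix.of (G + B)) r k) ∂ginOE d
      = ∫⁻ G, f (A.history (Matrix.of G) r k) * ENNReal.ofReal
          (likelihood (histProj k (A.history (Matrix.of G) r k)) (Matrix.of B) G) ∂ginOE d := by
  have hH : Measurable fun G : Fin d → Fin d → ℝ => A.history (Matrix.of G) r k :=
    A.measurable_history k measurable_const measurable_id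
  rw [lintegral_add_ginOE hd B (f := fun G => f (A.history (Matrix.of G) r k)) (hf.comp hH),
    A.lintegral_history_resample r k
      (f := fun x => f x.1 * ENNReal.ofReal (shiftDensity (Matrix.of B) x.2))
      ((hf.comp measurable_fst).mul ((measurable_shiftDensity _).comp measurable_snd).ennreal_ofReal)]
  refine lintegral_congr fun G => ?_
  set P := histProj k (A.history (Matrix.of G) r k)
  have hP : IsOrthProj P := isOrthProj_histProj _ _
  have hm : Measurable fun G' => shiftDensity (Matrix.of B) (resample (1 - P) G G') :=
    (measurable_shiftDensity _).comp
      (measurable_resample (fun i j => measurable_const) measurable_const measurable_id)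
  dsimp only
  rw [lintegral_const_mul _ hm.ennreal_ofReal]
  congr 1
  have e : ∀ G', ENNReal.ofReal (shiftDensity (Matrix.of B) (resample (1 - P) G G'))
      = ENNReal.ofReal (Real.exp (d * frob (Matrix.of G - (1 - P) * Matrix.of G * (1 - P))
          (Matrix.of B) - d / 2 * frob (Matrix.of B) (Matrix.of B)))
        * ENNReal.ofReal (Real.exp (d * frob (Matrix.of G')
          ((1 - P) * Matrix.of B * (1 - P)))) := by
    intro G'
    rw [← ENNReal.ofReal_mul (Real.exp_pos _).le, ← Real.exp_add, shiftDensity]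
    congr 2
    have : Matrix.of (resample (1 - P) G G')
      = Matrix.of G - (1 - P) * Matrix.of G * (1 - P) + (1 - P) * Matrix.of G' * (1 - P) := rfl
    rw [this, frob_add_left, frob_compress _ _ hP.compl.symm]
    ring
  simp_rw [e]
  rw [lintegral_const_mul' _ _ ENNReal.ofReal_ne_top, lintegral_exp_frob_ginOE hd,
    ← ENNReal.ofReal_mul (Real.exp_pos _).le, ← Real.exp_add, likelihood]
  congr 2
  ring

end History

/-! ### One query increases the overlap by a bounded factor only -/

section Increase

variable {d T : ℕ} {R : Type*} [MeasurableSpace R]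

/-- The rank-one perturbation `lam • u_l u_r^*`. -/
def spike (lam : ℝ) (u : UnitSphere d × UnitSphere d) : Fin d → Fin d → ℝ :=
  Matrix.of.symm (lam • Matrix.vecMulVec u.1.1.ofLp u.2.1.ofLp)

lemma measurable_spike (lam : ℝ) :
    Measurable (spike lam : UnitSphere d × UnitSphere d → Fin d → Fin d → ℝ) := by
  refine measurable_pi_iff.2 fun i => measurable_pi_iff.2 fun j => ?_
  simp only [spike, Matrix.of_symm_apply, Matrix.smul_apply, Matrix.vecMulVec_apply, smul_eq_mul]
  fun_prop

/-- The sum of the squared lengths of the projections of two unit vectors. -/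
def totSq (P : Matrix (Fin d) (Fin d) ℝ) (u : UnitSphere d × UnitSphere d) : ℝ :=
  projSq P u.1.1.ofLp + projSq P u.2.1.ofLp

lemma measurable_totSq {X : Type*} [MeasurableSpace X] {P : X → Matrix (Fin d) (Fin d) ℝ}
    {u : X → UnitSphere d × UnitSphere d} (hP : ∀ i j, Measurable fun x => P x i j)
    (hu : Measurable u) : Measurable fun x => totSq (P x) (u x) := by
  have h1 : ∀ i, Measurable fun x => (u x).1.1.ofLp i := fun i => by fun_prop
  have h2 : ∀ i, Measurable fun x => (u x).2.1.ofLp i := fun i => by fun_prop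
  simp only [totSq, projSq, Matrix.mulVec, dotProduct]
  fun_prop

lemma lintegral_exp_totSq_le (hd : 1 ≤ d) {P : (Fin d → Fin d → ℝ) → Matrix (Fin d) (Fin d) ℝ}
    (hPm : ∀ i j, Measurable fun G => P G i j) (hP : ∀ G, IsOrthProj (P G)) {δ b : ℝ} (hb : 0 < b)
    (hdet : ∀ G, b ≤ (1 - (1 - δ) • P G).det) :
    ∫⁻ u, ∫⁻ G, ENNReal.ofReal (Real.exp ((1 - δ ^ 2) / 2 * d * totSq (P G) u)) ∂ginOE d
        ∂(uniformSphere d).prod (uniformSphere d) ≤ ENNReal.ofReal (b⁻¹ ^ 2) := by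
  have := isProbabilityMeasure_uniformSphere hd
  have hm : Measurable fun x : (Fin d → Fin d → ℝ) × (UnitSphere d × UnitSphere d) =>
      ENNReal.ofReal (Real.exp ((1 - δ ^ 2) / 2 * d * totSq (P x.1) x.2)) := by
    have := measurable_totSq (P := fun x : (Fin d → Fin d → ℝ) × (UnitSphere d × UnitSphere d) =>
      P x.1) (fun i j => (hPm i j).comp measurable_fst) measurable_snd
    exact (Real.measurable_exp.comp (this.const_mul _)).ennreal_ofReal
  rw [lintegral_lintegral_swap (f := fun (u : UnitSphere d × UnitSphere d) G =>
    ENNReal.ofReal (Real.exp ((1 - δ ^ 2) / 2 * d * totSq (P G) u)))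
    (hm.comp measurable_swap).aemeasurable]
  calc _ ≤ ∫⁻ _, ENNReal.ofReal (b⁻¹ ^ 2) ∂ginOE d :=
        lintegral_mono fun G => lintegral_exp_projSq_add_le hd (hP G) hb (hdet G)
    _ = _ := by rw [lintegral_const, measure_univ, mul_one]

/-- A power of the likelihood ratio for `B` is the likelihood ratio for a multiple of `B`, up to a
factor that is bounded if `u_l` and `u_r` have small projections. -/
lemma exp_mul_log_likelihood_le {P : Matrix (Fin d) (Fin d) ℝ} (hP : IsOrthProj P) {lam p τ : ℝ}
    (hp : 1 ≤ p) {u : UnitSphere d × UnitSphere d} (hτ : totSq P u ≤ τ) (G : Fin d → Fin d → ℝ) :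
    Real.exp (p * Real.log (likelihood P (Matrix.of (spike lam u)) G))
      ≤ Real.exp ((p ^ 2 - p) / 2 * lam ^ 2 * (d * τ))
        * likelihood P (p • Matrix.of (spike lam u)) G := by
  have hN := frob_vecMulVec_sub_compress_le hP lam (UnitSphere.dotProduct_self u.1)
    (UnitSphere.dotProduct_self u.2)
  change frob (Matrix.of (spike lam u)) (Matrix.of (spike lam u))
      - frob ((1 - P) * Matrix.of (spike lam u) * (1 - P))
          ((1 - P) * Matrix.of (spike lam u) * (1 - P)) ≤ lam ^ 2 * totSq P u at hN
  generalize Matrix.of (spike lam u) = B at hN ⊢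
  rw [likelihood, likelihood, Real.log_exp, ← Real.exp_add, Real.exp_le_exp, Matrix.mul_smul,
    Matrix.smul_mul]
  simp only [frob_smul_left, frob_smul_right]
  have h1 : (p ^ 2 - p) / 2 * d * (frob B B - frob ((1 - P) * B * (1 - P)) ((1 - P) * B * (1 - P)))
      ≤ (p ^ 2 - p) / 2 * d * (lam ^ 2 * τ) := by
    have : 0 ≤ (p ^ 2 - p) / 2 * d := mul_nonneg (by nlinarith) (Nat.cast_nonneg d)
    refine mul_le_mul_of_nonneg_left (hN.trans ?_) this
    gcongr
  linarith

/-- Below the level `exp κ` the likelihood ratio is bounded by `exp κ`, and above it by a power of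
itself. On the event that `u_l` and `u_r` have small projections on the range of `P`, and large
projections on the range of `P'`, this bounds it by two terms with small averages. -/
lemma likelihood_le_add {P P' : Matrix (Fin d) (Fin d) ℝ} (hP : IsOrthProj P)
    {lam p s κ τ τ' : ℝ} (hp : 1 ≤ p) (hs : 0 ≤ s) {u : UnitSphere d × UnitSphere d}
    (hτ : totSq P u ≤ τ) (hτ' : τ' ≤ totSq P' u) (G : Fin d → Fin d → ℝ) :
    likelihood P (Matrix.of (spike lam u)) G
      ≤ Real.exp (κ - s * (d * τ')) * Real.exp (s * d * totSq P' u)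
        + Real.exp ((p ^ 2 - p) / 2 * lam ^ 2 * (d * τ) - (p - 1) * κ)
          * likelihood P (p • Matrix.of (spike lam u)) G := by
  have hL := exp_mul_log_likelihood_le hP (lam := lam) hp hτ G
  set ℓ := Real.log (likelihood P (Matrix.of (spike lam u)) G) with hℓ
  have hℓe : likelihood P (Matrix.of (spike lam u)) G = Real.exp ℓ :=
    (Real.exp_log (Real.exp_pos _)).symm
  have hs0 : 0 ≤ s * d := mul_nonneg hs (Nat.cast_nonneg d)
  rw [hℓe]
  rcases le_total ℓ κ with hle | hle
  · refine le_add_of_le_of_nonneg ?_ (mul_nonneg (Real.exp_pos _).le (likelihood_nonneg _ _ _))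
    rw [← Real.exp_add, Real.exp_le_exp]
    linarith [mul_le_mul_of_nonneg_left hτ' hs0]
  · refine le_add_of_nonneg_of_le (by positivity) ?_
    calc Real.exp ℓ ≤ Real.exp (-((p - 1) * κ)) * Real.exp (p * ℓ) := by
          rw [← Real.exp_add, Real.exp_le_exp]
          linarith [mul_le_mul_of_nonneg_left hle (sub_nonneg.2 hp)]
      _ ≤ _ := mul_le_mul_of_nonneg_left hL (Real.exp_pos _).le
      _ = _ := by
          rw [← mul_assoc, ← Real.exp_add]
          congr 2; ring

/-- The average over `G + lam • u_l u_r^*` is one over `G`, weighted by the likelihood ratio. -/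
lemma Algorithm.measure_history_mem (hd : 1 ≤ d) (A : Algorithm d T R) (r : R) (k : ℕ) (lam : ℝ)
    {E : Set ((Fin k → Triple d) × (UnitSphere d × UnitSphere d))} (hE : MeasurableSet E) :
    ((ginOE d).prod ((uniformSphere d).prod (uniformSphere d)))
        {x | (A.history (perturbed lam x.1 x.2.1 x.2.2) r k, x.2) ∈ E}
      = ∫⁻ u, ∫⁻ G, E.indicator (fun _ => (1 : ℝ≥0∞)) (A.history (Matrix.of G) r k, u)
          * ENNReal.ofReal (likelihood (histProj k (A.history (Matrix.of G) r k))
            (Matrix.of (spike lam u)) G) ∂ginOE d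
          ∂(uniformSphere d).prod (uniformSphere d) := by
  have := isProbabilityMeasure_uniformSphere hd
  have hφ : Measurable fun x : (Fin d → Fin d → ℝ) × (UnitSphere d × UnitSphere d) =>
      (A.history (Matrix.of (x.1 + spike lam x.2)) r k, x.2) :=
    (A.measurable_history k measurable_const
      (measurable_fst.add ((measurable_spike lam).comp measurable_snd))).prodMk measurable_snd
  have hI : Measurable (E.indicator (fun _ => (1 : ℝ≥0∞))) := measurable_const.indicator hE
  have e : ((ginOE d).prod ((uniformSphere d).prod (uniformSphere d)))
        {x | (A.history (perturbed lam x.1 x.2.1 x.2.2) r k, x.2) ∈ E}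
      = ∫⁻ x, E.indicator (fun _ => (1 : ℝ≥0∞))
          (A.history (Matrix.of (x.1 + spike lam x.2)) r k, x.2)
          ∂(ginOE d).prod ((uniformSphere d).prod (uniformSphere d)) :=
    (lintegral_indicator_one (hφ hE)).symm
  rw [e, lintegral_prod_symm (fun x => E.indicator (fun _ => (1 : ℝ≥0∞))
    (A.history (Matrix.of (x.1 + spike lam x.2)) r k, x.2)) (hI.comp hφ).aemeasurable]
  refine lintegral_congr fun u => ?_
  exact A.lintegral_history_add hd r k (spike lam u)
    (f := fun h => E.indicator (fun _ => (1 : ℝ≥0∞)) (h, u)) (hI.comp measurable_prodMk_right)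

lemma Algorithm.lintegral_likelihood (hd : 1 ≤ d) (A : Algorithm d T R) (r : R) (k : ℕ)
    (B : Fin d → Fin d → ℝ) :
    ∫⁻ G, ENNReal.ofReal (likelihood (histProj k (A.history (Matrix.of G) r k))
      (Matrix.of B) G) ∂ginOE d = 1 := by
  have := A.lintegral_history_add hd r k B (f := fun _ => 1) measurable_const
  simp only [one_mul, lintegral_one, measure_univ] at this
  exact this.symm

/-- If the queries so far have small overlap with `u_l` and `u_r`, then the next query, which
may depend on all observations, is unlikely to have a much larger one. -/
lemma Algorithm.measure_overlap_increase_le (hd : 1 ≤ d) (A : Algorithm d T R) (r : R) (k : ℕ)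
    {q : (Fin k → Triple d) → Fin d → ℂ} (hq : Measurable q) {lam δ p : ℝ} (hδ0 : 0 < δ)
    (hδ1 : δ ≤ 1) (hp : 1 ≤ p) (κ τ τ' : ℝ) :
    ((ginOE d).prod ((uniformSphere d).prod (uniformSphere d)))
      {x | totSq (histProj k (A.history (perturbed lam x.1 x.2.1 x.2.2) r k)) x.2 ≤ τ ∧
        τ' ≤ totSq (addProjC (histProj k (A.history (perturbed lam x.1 x.2.1 x.2.2) r k))
          (q (A.history (perturbed lam x.1 x.2.1 x.2.2) r k))) x.2}
      ≤ ENNReal.ofReal (Real.exp (κ - (1 - δ ^ 2) / 2 * (d * τ')) * ((δ ^ (2 * (k + 1)))⁻¹) ^ 2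
        + Real.exp ((p ^ 2 - p) / 2 * lam ^ 2 * (d * τ) - (p - 1) * κ)) := by
  have := isProbabilityMeasure_uniformSphere hd
  set s : ℝ := (1 - δ ^ 2) / 2 with hs
  set σ := (uniformSphere d).prod (uniformSphere d) with hσ
  set P' : (Fin k → Triple d) → Matrix (Fin d) (Fin d) ℝ := fun h => addProjC (histProj k h) (q h)
    with hP'
  have hP'm : ∀ i j, Measurable fun h => P' h i j :=
    measurable_addProjC (measurable_histProj k) hq
  set H : (Fin d → Fin d → ℝ) → (Fin k → Triple d) := fun G => A.history (Matrix.of G) r k with hH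
  have hHm : Measurable H := A.measurable_history k measurable_const measurable_id
  set E : Set ((Fin k → Triple d) × (UnitSphere d × UnitSphere d)) :=
    {y | totSq (histProj k y.1) y.2 ≤ τ ∧ τ' ≤ totSq (P' y.1) y.2} with hE
  have hEm : MeasurableSet E := by
    have e1 := measurable_totSq (X := (Fin k → Triple d) × (UnitSphere d × UnitSphere d))
      (fun i j => (measurable_histProj k i j).comp measurable_fst) measurable_snd
    have e2 := measurable_totSq (X := (Fin k → Triple d) × (UnitSphere d × UnitSphere d))
      (fun i j => (hP'm i j).comp measurable_fst) measurable_snd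
    exact (measurableSet_le e1 measurable_const).inter (measurableSet_le measurable_const e2)
  set c : ℝ := Real.exp ((p ^ 2 - p) / 2 * lam ^ 2 * (d * τ) - (p - 1) * κ) with hc
  have hpt : ∀ u G, E.indicator (fun _ => (1 : ℝ≥0∞)) (H G, u) * ENNReal.ofReal
        (likelihood (histProj k (H G)) (Matrix.of (spike lam u)) G)
      ≤ ENNReal.ofReal (Real.exp (κ - s * (d * τ')))
          * ENNReal.ofReal (Real.exp (s * d * totSq (P' (H G)) u))
        + ENNReal.ofReal c * ENNReal.ofReal
          (likelihood (histProj k (H G)) (Matrix.of (p • spike lam u)) G) := by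
    intro u G
    by_cases hmem : (H G, u) ∈ E
    · rw [Set.indicator_of_mem hmem, one_mul,
        ← ENNReal.ofReal_mul (Real.exp_pos _).le, ← ENNReal.ofReal_mul (Real.exp_pos _).le,
        ← ENNReal.ofReal_add (by positivity)
          (mul_nonneg (Real.exp_pos _).le (likelihood_nonneg _ _ _))]
      exact ENNReal.ofReal_le_ofReal (likelihood_le_add (isOrthProj_histProj k (H G)) hp
        (by rw [hs]; nlinarith) hmem.1 hmem.2 G)
    · rw [Set.indicator_of_notMem hmem, zero_mul]
      exact zero_le
  have h2 : ∫⁻ u, ∫⁻ G, ENNReal.ofReal (Real.exp (s * d * totSq (P' (H G)) u)) ∂ginOE d ∂σ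
      ≤ ENNReal.ofReal (((δ ^ (2 * (k + 1)))⁻¹) ^ 2) := by
    refine lintegral_exp_totSq_le hd (fun i j => (hP'm i j).comp hHm)
      (fun G => (isOrthProj_histProj k (H G)).addProjC _) (by positivity) fun G => ?_
    have := (isOrthProj_histProj k (H G)).det_addProjC hδ0.le hδ1 (by positivity)
      (le_det_histProj hδ0.le hδ1 k (H G)) (q (H G))
    rwa [← pow_add, show 2 + 2 * k = 2 * (k + 1) by ring] at this
  have hm1' : ∀ u, Measurable fun G =>
      ENNReal.ofReal (Real.exp (s * d * totSq (P' (H G)) u)) := fun u =>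
    (Real.measurable_exp.comp ((measurable_totSq (fun i j => (hP'm i j).comp hHm)
      measurable_const).const_mul _)).ennreal_ofReal
  refine (A.measure_history_mem hd r k lam hEm).trans_le ?_
  calc _ ≤ ∫⁻ u, (ENNReal.ofReal (Real.exp (κ - s * (d * τ')))
          * ∫⁻ G, ENNReal.ofReal (Real.exp (s * d * totSq (P' (H G)) u)) ∂ginOE d
          + ENNReal.ofReal c) ∂σ := by
        refine lintegral_mono fun u => (lintegral_mono fun G => hpt u G).trans (le_of_eq ?_)
        rw [lintegral_add_left ((hm1' u).const_mul _), lintegral_const_mul _ (hm1' u),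
          lintegral_const_mul' _ _ ENNReal.ofReal_ne_top, A.lintegral_likelihood hd, mul_one]
    _ ≤ ENNReal.ofReal (Real.exp (κ - s * (d * τ')))
          * ENNReal.ofReal (((δ ^ (2 * (k + 1)))⁻¹) ^ 2) + ENNReal.ofReal c := by
        rw [lintegral_add_right _ measurable_const, lintegral_const_mul' _ _ ENNReal.ofReal_ne_top,
          lintegral_const, measure_univ, mul_one]
        gcongr
    _ = _ := by
        rw [← ENNReal.ofReal_mul (Real.exp_pos _).le,
          ← ENNReal.ofReal_add (by positivity) (Real.exp_pos _).le]

end Increase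

/-! ### The outputs, and the choice of the parameters -/

section Output

variable {d T : ℕ} {R : Type*} [MeasurableSpace R]

/-- The two output vectors, encoded as one last complex query. -/
def Algorithm.outQuery (A : Algorithm d T R) (r : R) (h : Fin T → Triple d) : Fin d → ℂ :=
  fun i => (((A.outLeft r h).1.ofLp i : ℝ) : ℂ)
    + (((A.outRight r h).1.ofLp i : ℝ) : ℂ) * Complex.I

lemma Algorithm.measurable_outQuery (A : Algorithm d T R) (r : R) :
    Measurable (A.outQuery r) := by
  have h1 : Measurable fun h => A.outLeft r h := A.measurable_outLeft.comp measurable_prodMk_left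
  have h2 : Measurable fun h => A.outRight r h := A.measurable_outRight.comp measurable_prodMk_left
  refine measurable_pi_iff.2 fun i => ?_
  have h1' : Measurable fun h => (A.outLeft r h).1.ofLp i := by fun_prop
  have h2' : Measurable fun h => (A.outRight r h).1.ofLp i := by fun_prop
  unfold outQuery
  fun_prop

lemma Algorithm.overlap_le (A : Algorithm d T R) (lam : ℝ) (r : R) (G : Fin d → Fin d → ℝ)
    (u : UnitSphere d × UnitSphere d) :
    A.overlap lam r G u.1 u.2
      ≤ totSq (addProjC (histProj T (A.history (perturbed lam G u.1 u.2) r T))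
          (A.outQuery r (A.history (perturbed lam G u.1 u.2) r T))) u := by
  set h := A.history (perturbed lam G u.1 u.2) r T with hh
  have hP := isOrthProj_histProj T h
  have hre := hP.addProjC_mulVec_re (A.outQuery r h)
  have him := hP.addProjC_mulVec_im (A.outQuery r h)
  have e1 : (fun i => (A.outQuery r h i).re) = (A.outLeft r h).1.ofLp := by
    ext i; simp [outQuery]
  have e2 : (fun i => (A.outQuery r h i).im) = (A.outRight r h).1.ofLp := by
    ext i; simp [outQuery]
  rw [e1] at hre
  rw [e2] at him
  have hi : ∀ v w : UnitSphere d, |inner ℝ v.1 w.1| ^ 2 = (v.1.ofLp ⬝ᵥ w.1.ofLp) ^ 2 := by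
    intro v w
    rw [sq_abs, EuclideanSpace.inner_eq_star_dotProduct, dotProduct_comm]
    simp
  rw [overlap, vLeft, vRight, hi, hi, totSq]
  exact add_le_add ((hP.addProjC _).dotProduct_sq_le hre (UnitSphere.dotProduct_self _) _)
    ((hP.addProjC _).dotProduct_sq_le him (UnitSphere.dotProduct_self _) _)

/-- If the final overlap exceeds the last threshold, then it has passed from below `τ k` to above
`τ (k + 1)` at some query (counting the output as the last one). -/
lemma Algorithm.setOf_le_overlap_subset (A : Algorithm d T R) (lam : ℝ) (r : R) {τ : ℕ → ℝ} {θ : ℝ}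
    (h0 : 0 ≤ τ 0) (hθ : τ (T + 1) ≤ θ) :
    {x : (Fin d → Fin d → ℝ) × (UnitSphere d × UnitSphere d) |
        θ ≤ A.overlap lam r x.1 x.2.1 x.2.2}
      ⊆ (⋃ k ∈ Finset.range T,
          {x | totSq (histProj k (A.history (perturbed lam x.1 x.2.1 x.2.2) r k)) x.2 ≤ τ k ∧
            τ (k + 1) ≤ totSq (addProjC (histProj k (A.history (perturbed lam x.1 x.2.1 x.2.2) r k))
              (A.query k r (A.history (perturbed lam x.1 x.2.1 x.2.2) r k))) x.2})
        ∪ {x | totSq (histProj T (A.history (perturbed lam x.1 x.2.1 x.2.2) r T)) x.2 ≤ τ T ∧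
            τ (T + 1) ≤ totSq (addProjC (histProj T (A.history (perturbed lam x.1 x.2.1 x.2.2) r T))
              (A.outQuery r (A.history (perturbed lam x.1 x.2.1 x.2.2) r T))) x.2} := by
  intro x hx
  by_contra hcon
  simp only [Set.mem_union, Set.mem_iUnion, Finset.mem_range, Set.mem_ofPred_eq, not_or,
    not_exists, not_and, not_le] at hcon
  obtain ⟨hk, hT⟩ := hcon
  have key : ∀ k ≤ T,
      totSq (histProj k (A.history (perturbed lam x.1 x.2.1 x.2.2) r k)) x.2 ≤ τ k := by
    intro k
    induction k with
    | zero => intro _; simpa [histProj, totSq, projSq] using h0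
    | succ k ih =>
      intro hkT
      have := (hk k (by omega) (ih (by omega))).le
      simpa [histProj, Algorithm.history, answer] using this
  exact absurd (hT (key T le_rfl)) (not_lt.2 (hθ.trans (hx.trans (A.overlap_le lam r x.1 x.2))))

/-- The bound for a single query, with thresholds growing by the factor `lam ^ 4`. Here
`δ = (lam - 1) / lam`, and `lam` is also used as the exponent of the likelihood ratio. -/
lemma Algorithm.measure_overlap_growth_le (hd : 1 ≤ d) (A : Algorithm d T R) (r : R) {k : ℕ}
    (hk : k ≤ T) {q : (Fin k → Triple d) → Fin d → ℂ} (hq : Measurable q) {lam : ℝ}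
    (hlam : 1 < lam) {τ : ℕ → ℝ} {l : ℝ} (hτ : ∀ k, d * τ k = lam ^ (4 * k) * l) (hl : 0 ≤ l) :
    ((ginOE d).prod ((uniformSphere d).prod (uniformSphere d)))
      {x | totSq (histProj k (A.history (perturbed lam x.1 x.2.1 x.2.2) r k)) x.2 ≤ τ k ∧
        τ (k + 1) ≤ totSq (addProjC (histProj k (A.history (perturbed lam x.1 x.2.1 x.2.2) r k))
          (q (A.history (perturbed lam x.1 x.2.1 x.2.2) r k))) x.2}
      ≤ ENNReal.ofReal (Real.exp (-((lam - 1) / lam ^ 2 / 4 * l))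
            * ((((lam - 1) / lam) ^ (2 * (T + 1)))⁻¹) ^ 2
          + Real.exp (-((lam - 1) * ((lam - 1) / lam ^ 2 / 4 * l)))) := by
  have hlam0 : 0 < lam := by linarith
  set δ := (lam - 1) / lam with hδ
  have hδ0 : 0 < δ := div_pos (by linarith) hlam0
  have hδ1 : δ ≤ 1 := (div_le_one hlam0).2 (by linarith)
  have hδlam : (lam - 1) / lam ^ 2 = δ - δ ^ 2 := by rw [hδ]; field_simp; ring
  have hδlam' : lam * (1 - δ) = 1 := by rw [hδ]; field_simp; ring
  have hη : 0 ≤ (δ - δ ^ 2) / 4 := by nlinarith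
  -- `κ` lies halfway between `(1 - δ) / 2 * (d * τ (k + 1))`, where the second term of the bound
  -- stops being small, and `(1 - δ ^ 2) / 2 * (d * τ (k + 1))`, where the first term does.
  refine (A.measure_overlap_increase_le hd r k hq (p := lam) hδ0 hδ1 hlam.le
    ((2 - δ - δ ^ 2) / 4 * (d * τ (k + 1))) (τ k) (τ (k + 1))).trans (ENNReal.ofReal_le_ofReal ?_)
  rw [hδlam]
  have hstep : (d : ℝ) * τ (k + 1) = lam ^ 4 * (d * τ k) := by
    rw [hτ, hτ]; ring
  have hge : l ≤ d * τ (k + 1) := by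
    rw [hτ]
    exact le_mul_of_one_le_left hl (one_le_pow₀ hlam.le)
  have hmul : (δ - δ ^ 2) / 4 * l ≤ (δ - δ ^ 2) / 4 * (d * τ (k + 1)) :=
    mul_le_mul_of_nonneg_left hge hη
  refine add_le_add (mul_le_mul ?_ ?_ (by positivity) (Real.exp_pos _).le) ?_
  · rw [Real.exp_le_exp]
    linarith
  · gcongr 1
    refine inv_anti₀ (by positivity) (pow_le_pow_of_le_one hδ0.le hδ1 (by omega))
  · rw [Real.exp_le_exp]
    have e : (lam ^ 2 - lam) / 2 * lam ^ 2 * (d * τ k)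
        = (lam - 1) * ((1 - δ) / 2 * (d * τ (k + 1))) := by
      rw [hstep]
      linear_combination (-(lam - 1) / 2 * lam ^ 3 * (d * τ k)) * hδlam'
    rw [e]
    linarith [mul_le_mul_of_nonneg_left hmul (sub_nonneg.2 hlam.le)]

lemma Algorithm.measure_le_overlap_le (hd : 1 ≤ d) (A : Algorithm d T R) (r : R) {lam : ℝ}
    (hlam : 1 < lam) {l θ : ℝ} (hl : 0 ≤ l) (hθ : lam ^ (4 * (T + 1)) * l / d ≤ θ) :
    ((ginOE d).prod ((uniformSphere d).prod (uniformSphere d)))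
      {x | θ ≤ A.overlap lam r x.1 x.2.1 x.2.2}
      ≤ ENNReal.ofReal ((T + 1) * (Real.exp (-((lam - 1) / lam ^ 2 / 4 * l))
            * ((((lam - 1) / lam) ^ (2 * (T + 1)))⁻¹) ^ 2
          + Real.exp (-((lam - 1) * ((lam - 1) / lam ^ 2 / 4 * l))))) := by
  have hd0 : (d : ℝ) ≠ 0 := by exact_mod_cast (by omega : d ≠ 0)
  set τ : ℕ → ℝ := fun k => lam ^ (4 * k) * l / d with hτ
  have hτd : ∀ k, d * τ k = lam ^ (4 * k) * l := fun k => by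
    simp only [hτ]; field_simp
  have h0 : 0 ≤ τ 0 := by simp only [hτ]; positivity
  set b := Real.exp (-((lam - 1) / lam ^ 2 / 4 * l))
            * ((((lam - 1) / lam) ^ (2 * (T + 1)))⁻¹) ^ 2
          + Real.exp (-((lam - 1) * ((lam - 1) / lam ^ 2 / 4 * l)))
  refine (measure_mono (A.setOf_le_overlap_subset lam r h0 hθ)).trans ?_
  refine (measure_union_le _ _).trans ?_
  calc _ ≤ (∑ k ∈ Finset.range T, ENNReal.ofReal b) + ENNReal.ofReal b := by
        refine add_le_add ((measure_biUnion_finset_le _ _).trans (Finset.sum_le_sum fun k hk => ?_))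
          (A.measure_overlap_growth_le hd r le_rfl (A.measurable_outQuery r) hlam hτd hl)
        exact A.measure_overlap_growth_le hd r (Finset.mem_range.1 hk).le
          ((A.measurable_query k).comp measurable_prodMk_left) hlam hτd hl
    _ = _ := by
        rw [Finset.sum_const, Finset.card_range, nsmul_eq_mul, ENNReal.ofReal_mul (by positivity),
          ENNReal.ofReal_add (by positivity) zero_le_one, ENNReal.ofReal_one,
          ENNReal.ofReal_natCast]
        ring

/-- It suffices to bound the probability of a large overlap for each value of the seed. -/
lemma Algorithm.one_sub_le_jointLaw (hd : 1 ≤ d) {ν : Measure R} [IsProbabilityMeasure ν]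
    (A : Algorithm d T R) {lam θ ε : ℝ} (hε : 0 ≤ ε)
    (h : ∀ r, ((ginOE d).prod ((uniformSphere d).prod (uniformSphere d)))
      {x | θ ≤ A.overlap lam r x.1 x.2.1 x.2.2} ≤ ENNReal.ofReal ε) :
    1 - ε ≤ (jointLaw d ν).real {x | A.overlap lam x.1 x.2.1 x.2.2.1 x.2.2.2 < θ} := by
  have := isProbabilityMeasure_uniformSphere hd
  have : IsProbabilityMeasure (jointLaw d ν) := by unfold jointLaw; infer_instance
  have hM : ∀ k, Measurable
      fun x : R × (Fin d → Fin d → ℝ) × UnitSphere d × UnitSphere d =>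
        A.history (perturbed lam x.2.1 x.2.2.1 x.2.2.2) x.1 k := fun k =>
    A.measurable_history k measurable_fst
      ((measurable_fst.comp measurable_snd).add
        ((measurable_spike lam).comp (measurable_snd.comp measurable_snd)))
  have hm : Measurable fun x : R × (Fin d → Fin d → ℝ) × UnitSphere d × UnitSphere d =>
      A.overlap lam x.1 x.2.1 x.2.2.1 x.2.2.2 := by
    have h1 := A.measurable_outLeft.comp (measurable_fst.prodMk (hM T))
    have h2 := A.measurable_outRight.comp (measurable_fst.prodMk (hM T))
    have h1' := (measurable_subtype_coe.comp h1).inner (𝕜 := ℝ)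
      (measurable_subtype_coe.comp (measurable_fst.comp (measurable_snd.comp measurable_snd)))
    have h2' := (measurable_subtype_coe.comp h2).inner (𝕜 := ℝ)
      (measurable_subtype_coe.comp (measurable_snd.comp (measurable_snd.comp measurable_snd)))
    exact ((continuous_abs.measurable.comp h1').pow_const 2).add
      ((continuous_abs.measurable.comp h2').pow_const 2)
  set S := {x : R × (Fin d → Fin d → ℝ) × UnitSphere d × UnitSphere d |
    A.overlap lam x.1 x.2.1 x.2.2.1 x.2.2.2 < θ} with hS
  have hSm : MeasurableSet S := measurableSet_lt hm measurable_const
  have hc : jointLaw d ν Sᶜ ≤ ENNReal.ofReal ε := by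
    rw [jointLaw, Measure.prod_apply hSm.compl]
    calc _ ≤ ∫⁻ _, ENNReal.ofReal ε ∂ν := by
          refine lintegral_mono fun r => (le_of_eq ?_).trans (h r)
          congr 1
          ext x
          simp [hS]
      _ = _ := by rw [lintegral_const, measure_univ, mul_one]
  have hc' : (jointLaw d ν).real Sᶜ ≤ ε := ENNReal.toReal_le_of_le_ofReal hε hc
  rw [probReal_compl_eq_one_sub hSm] at hc'
  linarith

/-- The bound on the probability of success in dimension `d`, as a function of `L = log d`. -/
def errorBound (lam L : ℝ) : ℝ :=
  (L / (5 * (lam - 1)) + 1) * (Real.exp (-((lam - 1) / lam ^ 2 / 4 * L ^ 2))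
      * Real.exp (4 * (-Real.log ((lam - 1) / lam)) * (L / (5 * (lam - 1)) + 1))
    + Real.exp (-((lam - 1) * ((lam - 1) / lam ^ 2 / 4 * L ^ 2))))

lemma errorBound_nonneg {lam L : ℝ} (hlam : 1 < lam) (hL : 0 ≤ L) : 0 ≤ errorBound lam L := by
  have : 0 < lam - 1 := by linarith
  unfold errorBound
  positivity

lemma tendsto_errorBound {lam : ℝ} (hlam : 1 < lam) : Tendsto (errorBound lam) atTop (𝓝 0) := by
  have hl : 0 < lam - 1 := by linarith
  have hη : 0 < (lam - 1) / lam ^ 2 / 4 := by positivity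
  have hc : 0 < 1 / (5 * (lam - 1)) := by positivity
  have ha : 0 ≤ -Real.log ((lam - 1) / lam) := by
    rw [neg_nonneg]
    exact Real.log_nonpos (by positivity) ((div_le_one (by linarith)).2 (by linarith))
  set η := (lam - 1) / lam ^ 2 / 4
  set a := -Real.log ((lam - 1) / lam)
  set c := 1 / (5 * (lam - 1)) with hcdef
  have hlim : Tendsto (fun L : ℝ => 2 * c * (L ^ 1 * Real.exp (-L)) + 2 * Real.exp (-L))
      atTop (𝓝 0) := by
    have h1 := (Real.tendsto_pow_mul_exp_neg_atTop_nhds_zero 1).const_mul (2 * c)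
    have h2 := (Real.tendsto_exp_neg_atTop_nhds_zero).const_mul 2
    simpa using h1.add h2
  refine squeeze_zero' ?_ ?_ hlim
  · filter_upwards [eventually_ge_atTop 0] with L hL using errorBound_nonneg hlam hL
  · filter_upwards [eventually_ge_atTop 1, eventually_ge_atTop ((4 * a * (c + 1) + 1) / η),
      eventually_ge_atTop (1 / ((lam - 1) * η))] with L h1 h2 h3
    have e1 : 4 * a * (c + 1) + 1 ≤ L * η := (div_le_iff₀ hη).1 h2
    have e2 : 1 ≤ L * ((lam - 1) * η) := (div_le_iff₀ (by positivity)).1 h3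
    have hLc : L / (5 * (lam - 1)) = c * L := by rw [hcdef]; ring
    have b1 : Real.exp (-(η * L ^ 2)) * Real.exp (4 * a * (L / (5 * (lam - 1)) + 1))
        ≤ Real.exp (-L) := by
      rw [← Real.exp_add, Real.exp_le_exp, hLc]
      nlinarith [mul_le_mul_of_nonneg_right e1 (by linarith : (0 : ℝ) ≤ L),
        mul_nonneg ha (sub_nonneg.2 h1)]
    have b2 : Real.exp (-((lam - 1) * (η * L ^ 2))) ≤ Real.exp (-L) := by
      rw [Real.exp_le_exp]
      nlinarith [mul_le_mul_of_nonneg_right e2 (by linarith : (0 : ℝ) ≤ L)]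
    calc errorBound lam L ≤ (L / (5 * (lam - 1)) + 1) * (Real.exp (-L) + Real.exp (-L)) := by
          unfold errorBound
          have : 0 ≤ L := by linarith
          gcongr
      _ = _ := by rw [hLc]; ring

lemma tendsto_threshold (lam : ℝ) :
    Tendsto (fun L : ℝ => lam ^ 4 * (L ^ 2 * Real.exp (-(L / 5)))) atTop (𝓝 0) := by
  have h := ((Real.tendsto_pow_mul_exp_neg_atTop_nhds_zero 2).comp
    (tendsto_id.atTop_div_const (by norm_num : (0 : ℝ) < 5))).const_mul (lam ^ 4 * 25)
  rw [mul_zero] at h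
  refine h.congr fun L => ?_
  simp only [Function.comp, id]
  ring

/-- With at most `log d / (5 (lam - 1))` queries, the overlap grows by at most `d ^ (4 / 5)`. -/
lemma pow_mul_div_le {lam : ℝ} (hlam : 1 < lam) (hd : 1 ≤ d)
    (hT : (T : ℝ) ≤ Real.log d / (5 * (lam - 1))) :
    lam ^ (4 * (T + 1)) * Real.log d ^ 2 / d
      ≤ lam ^ 4 * (Real.log d ^ 2 * Real.exp (-(Real.log d / 5))) := by
  have hd0 : (0 : ℝ) < d := by exact_mod_cast hd
  have hl : 0 < lam - 1 := by linarith
  have hlam0 : 0 < lam := by linarith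
  have hT' : T * (5 * (lam - 1)) ≤ Real.log d := (le_div_iff₀ (by positivity)).1 hT
  have h1 : lam ^ (4 * T) ≤ Real.exp (4 / 5 * Real.log d) := by
    calc lam ^ (4 * T) ≤ Real.exp (lam - 1) ^ (4 * T) := by
          gcongr
          linarith [Real.add_one_le_exp (lam - 1)]
      _ = Real.exp (4 * (T * (lam - 1))) := by
          rw [← Real.exp_nat_mul]; congr 1; push_cast; ring
      _ ≤ _ := by rw [Real.exp_le_exp]; linarith
  have h2 : Real.exp (4 / 5 * Real.log d) / d = Real.exp (-(Real.log d / 5)) := by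
    nth_rewrite 2 [← Real.exp_log hd0]
    rw [← Real.exp_sub]
    congr 1; ring
  calc lam ^ (4 * (T + 1)) * Real.log d ^ 2 / d
      = lam ^ 4 * (Real.log d ^ 2 * (lam ^ (4 * T) / d)) := by ring
    _ ≤ lam ^ 4 * (Real.log d ^ 2 * (Real.exp (4 / 5 * Real.log d) / d)) := by gcongr
    _ = _ := by rw [h2]

lemma le_errorBound {lam L : ℝ} (hlam : 1 < lam) (hT : (T : ℝ) ≤ L / (5 * (lam - 1))) :
    (T + 1) * (Real.exp (-((lam - 1) / lam ^ 2 / 4 * L ^ 2))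
            * ((((lam - 1) / lam) ^ (2 * (T + 1)))⁻¹) ^ 2
          + Real.exp (-((lam - 1) * ((lam - 1) / lam ^ 2 / 4 * L ^ 2)))) ≤ errorBound lam L := by
  have hδ0 : 0 < (lam - 1) / lam := div_pos (by linarith) (by linarith)
  have ha : 0 ≤ -Real.log ((lam - 1) / lam) := by
    rw [neg_nonneg]
    exact Real.log_nonpos hδ0.le ((div_le_one (by linarith)).2 (by linarith))
  have h1 : ((((lam - 1) / lam) ^ (2 * (T + 1)))⁻¹) ^ 2
      ≤ Real.exp (4 * (-Real.log ((lam - 1) / lam)) * (L / (5 * (lam - 1)) + 1)) := by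
    calc ((((lam - 1) / lam) ^ (2 * (T + 1)))⁻¹) ^ 2
        = Real.exp (4 * (-Real.log ((lam - 1) / lam)) * (T + 1)) := by
          nth_rewrite 1 [← Real.exp_log hδ0]
          rw [← Real.exp_nat_mul, ← Real.exp_neg, ← Real.exp_nat_mul]
          congr 1; push_cast; ring
      _ ≤ _ := by
          rw [Real.exp_le_exp]
          exact mul_le_mul_of_nonneg_left (by linarith) (by positivity)
  have h0 : 0 ≤ L / (5 * (lam - 1)) + 1 := by
    linarith [(Nat.cast_nonneg T : (0 : ℝ) ≤ T)]
  unfold errorBound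
  gcongr

end Output

end TwoSideQuery

end

theorem mainTheorem3 (lam : ℝ) (hlam : 1 < lam) :
    ∃ ε : ℕ → ℝ, Tendsto ε atTop (𝓝 0) ∧
      ∀ (d : ℕ), 1 ≤ d → ∀ (T : ℕ), (T : ℝ) ≤ Real.log d / (5 * (lam - 1)) →
        ∀ (R : Type*) [MeasurableSpace R] (ν : Measure R) [IsProbabilityMeasure ν]
          (A : TwoSideQuery.Algorithm d T R),
          1 - ε d ≤ (TwoSideQuery.jointLaw d ν).real
            {x | A.overlap lam x.1 x.2.1 x.2.2.1 x.2.2.2 < (lam - 1) / 4} := by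
  classical
  have hlog : Tendsto (fun d : ℕ => Real.log d) atTop atTop :=
    Real.tendsto_log_atTop.comp tendsto_natCast_atTop_atTop
  -- In the finitely many dimensions where the final threshold exceeds `(lam - 1) / 4`, the
  -- trivial bound is used.
  refine ⟨fun d => if lam ^ 4 * (Real.log d ^ 2 * Real.exp (-(Real.log d / 5))) ≤ (lam - 1) / 4
    then TwoSideQuery.errorBound lam (Real.log d) else 1, ?_, ?_⟩
  · refine ((TwoSideQuery.tendsto_errorBound hlam).comp hlog).congr' ?_
    have hpos : 0 < (lam - 1) / 4 := by linarith
    filter_upwards [((TwoSideQuery.tendsto_threshold lam).comp hlog).eventually_le_const hpos]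
      with d hd
    exact (if_pos hd).symm
  · intro d hd T hT R _ ν _ A
    dsimp only
    split_ifs with hthr
    · refine A.one_sub_le_jointLaw hd (TwoSideQuery.errorBound_nonneg hlam
        (Real.log_natCast_nonneg d)) fun r => ?_
      exact (A.measure_le_overlap_le hd r hlam (sq_nonneg (Real.log d))
        ((TwoSideQuery.pow_mul_div_le hlam hd hT).trans hthr)).trans
        (ENNReal.ofReal_le_ofReal (TwoSideQuery.le_errorBound hlam hT))
    · simp
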